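/- **Theorem (acoustic case of the quasi-1D generalized Riemann problem for special relativistic hydrodynamics).** Let $\Gamma\in(1,2]$ and let $\mathbf h=(h_1,h_2,h_3,h_4)\in\mathbb R^4$ be constant. Consider $$\partial_t \mathbf U+\partial_x \mathbf F_1(\mathbf U)=\mathbf h,\qquad \mathbf U=(D,m_1,m_2,E),\quad \mathbf F_1=(Du,\;um_1+p,\;um_2,\;m_1),$$ with $D=\rho W$, $(m_1,m_2)=DhW(u,v)$, $E=DhW-p$, $W=(1-u^2-v^2)^{-1/2}$, $h=1+e+p/\rho$ and $p=(\Gamma-1)\rho e$. Admissible states satisfy $\rho>0$, $p>0$, $u^2+v^2<1$; write $\mathbf V=(\rho,u,v,p)$. Let the initial data be continuous at $x=0$ (so $\mathbf U_L=\mathbf U_R=\mathbf U_*$), with one-sided slopes $\mathbf V'_L$ and $\mathbf V'_R$ at $x=0$ (in general $\mathbf V'_L\ne\mathbf V'_R$). Let $\mathbf V$ be a continuous, piecewise $C^1$ admissible solution near the origin with these data: for some $T,\delta>0$, finitely many $C^1$ curves $x=s_i(t)$, $0\le t<T$, issue from the origin, are pairwise distinct and ordered for $t>0$, and in each open sector of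 $\{0<t<T,\ |x|<\delta\}$ between neighbouring curves (the two outermost sectors included) $\mathbf V$ is a classical solution whose first derivatives extend continuously to the closure of the sector within $\{0\le t<T,\ |x|<\delta\}$. For a component $w$ of $\mathbf V$ let $(\partial w/\partial t)_*=\lim_{t\to0+}\partial_t w(0,t)$, where the claim that this equals a number includes that $\partial_tw(0,t)$ exists for all small $t>0$ and that the limit exists. Put $c_s^2=\Gamma p/(\rho h)$, $H=1-u^2-v^2c_s^2$, $$\lambda_{1}=\frac{u(1-c_s^2)-c_sW^{-1}H^{1/2}}{1-(u^2+v^2)c_s^2},\quad \lambda_{4}=\frac{u(1-c_s^2)+c_sW^{-1}H^{1/2}}{1-(u^2+v^2)c_s^2},\quad \Phi=\frac{H^{1/2}}{\rho h c_sW},$$ $$M=u-\tfrac{\lambda_4+\lambda_1}{2},\quad N_u=\tfrac{\lambda_4-\lambda_1}{2}\Phi,\quad N_p=\tfrac{\lambda_4-\lambda_1}{2}\Phi^{-1},$$ $$C_4=\frac{h_4(\Gamma-1+(u^2+v^2)c_s^2)-\frac{\Gamma-1}{W}h_1-(c_s^2+\Gamma-1)(uh_2+vh_3)}{1-(u^2+v^2)c_s^2},\quad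 C_2=\frac{h_2-uh_4-uC_4}{\rho hW^2},$$ $$B_3=\tfrac1\rho\big(h_4-uh_2-vh_3-\tfrac hW h_1\big),\qquad B_4=-\tfrac{hv}{\rho}h_1+\tfrac{1}{\rho W}h_3,$$ all evaluated at the common state $\mathbf U_*$. If $\lambda_1<0<\lambda_4$, then $$\Big(\frac{\partial u}{\partial t}\Big)_*=\frac{1}{\lambda_4-\lambda_1}\Big(\lambda_4\big[C_2+(M+\lambda_1-u)u'_L-N_up'_L\big]-\lambda_1\big[C_2+(M+\lambda_4-u)u'_R-N_up'_R\big]\Big),$$ $$\Big(\frac{\partial p}{\partial t}\Big)_*=\frac{1}{\lambda_4-\lambda_1}\Big(\lambda_4\big[C_4+(M+\lambda_1-u)p'_L-N_pu'_L\big]-\lambda_1\big[C_4+(M+\lambda_4-u)p'_R-N_pu'_R\big]\Big).$$ Moreover, if $u_*\neq0$, let $K=L$ when $u_*>0$ and $K=R$ when $u_*<0$. Then $$\Big(\frac{\partial\rho}{\partial t}\Big)_*=\frac{1}{hc_s^2}\Big[\Big(\frac{\partial p}{\partial t}\Big)_*+u\,(p'_K-c_s^2h\,\rho'_K)-(\Gamma-1)\rho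 B_3\Big],$$ $$\Big(\frac{\partial v}{\partial t}\Big)_*=\frac{-1}{hW(v^2W^2+1)}\Big[Wv\,\partial_th+hvW^3u\,\Big(\frac{\partial u}{\partial t}\Big)_*-B_4+u\,\big(Wv\,\partial_xh+hvW^3u\,u'_K+hW(v^2W^2+1)v'_K\big)\Big],$$ where $\partial_th=\frac{\Gamma}{\Gamma-1}\big(\frac1\rho(\frac{\partial p}{\partial t})_*-\frac p{\rho^2}(\frac{\partial\rho}{\partial t})_*\big)$ and $\partial_xh=\frac{\Gamma}{\Gamma-1}\big(\frac1\rho p'_K-\frac p{\rho^2}\rho'_K\big)$. -/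

import Mathlib

open Set Filter Topology

noncomputable section

namespace RHD

/-! ### Primitive variables

A state is the vector `q = (ρ, u, v, p)` of primitive variables: rest-mass density, the two
velocity components (the speed of light is 1) and pressure. The same accessors are used for the
components of a slope `∂q/∂x`. -/

/-- Rest-mass density `ρ`. -/
def rho (q : Fin 4 → ℝ) : ℝ := q 0

/-- Normal velocity `u` (in the `x`-direction). -/
def velX (q : Fin 4 → ℝ) : ℝ := q 1

/-- Tangential velocity `v` (in the `y`-direction). -/
def velY (q : Fin 4 → ℝ) : ℝ := q 2

/-- Pressure `p`. -/
def pres (q : Fin 4 → ℝ) : ℝ := q 3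

/-- Physically admissible states. -/
def Admissible (q : Fin 4 → ℝ) : Prop :=
  0 < rho q ∧ 0 < pres q ∧ velX q ^ 2 + velY q ^ 2 < 1

/-- Lorentz factor `W = 1 / √(1 - (u² + v²))`. -/
def lorentz (q : Fin 4 → ℝ) : ℝ := 1 / Real.sqrt (1 - (velX q ^ 2 + velY q ^ 2))

/-- Specific internal energy `e`, from the `Γ`-law `p = (Γ - 1) ρ e`. -/
def internalEnergy (Γ : ℝ) (q : Fin 4 → ℝ) : ℝ := pres q / ((Γ - 1) * rho q)

/-- Specific enthalpy `h = 1 + e + p / ρ`. -/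
def enthalpy (Γ : ℝ) (q : Fin 4 → ℝ) : ℝ := 1 + internalEnergy Γ q + pres q / rho q

/-! ### The balance law in conservative form -/

/-- Conservative vector `U = (D, m₁, m₂, E)` with `D = ρ W`, `m = D h W (u, v)`,
`E = D h W - p`. -/
def consVec (Γ : ℝ) (q : Fin 4 → ℝ) : Fin 4 → ℝ :=
  let D := rho q * lorentz q
  ![D,
    D * enthalpy Γ q * lorentz q * velX q,
    D * enthalpy Γ q * lorentz q * velY q,
    D * enthalpy Γ q * lorentz q - pres q]

/-- Flux in the `x`-direction, `F₁ = (D u, u m₁ + p, u m₂, m₁)`. -/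
def fluxX (Γ : ℝ) (q : Fin 4 → ℝ) : Fin 4 → ℝ :=
  ![consVec Γ q 0 * velX q,
    velX q * consVec Γ q 1 + pres q,
    velX q * consVec Γ q 2,
    consVec Γ q 1]

/-! ### Solutions of the generalized Riemann problem

Points of space-time are pairs `(t, x)`. -/

/-- The space-time neighbourhood `0 ≤ t < T`, `|x| < δ` of the origin. -/
def spaceTime (T δ : ℝ) : Set (ℝ × ℝ) := Ico 0 T ×ˢ Ioo (-δ) δ

/-- The `k`-th open sector cut out by the curves `x = s i t`: the points with positive time that
lie to the right of the first `k` curves and to the left of all the others. -/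
def sector (T δ : ℝ) {n : ℕ} (s : Fin n → ℝ → ℝ) (k : ℕ) : Set (ℝ × ℝ) :=
  {z | z.1 ∈ Ioo 0 T ∧ z.2 ∈ Ioo (-δ) δ ∧
    ∀ i : Fin n, ((i : ℕ) < k → s i z.1 < z.2) ∧ (k ≤ (i : ℕ) → z.2 < s i z.1)}

/-- `V` is, on the neighbourhood `spaceTime T δ` of the origin, a continuous and piecewise `C¹`
solution of the quasi one-dimensional system `∂ₜ U + ∂ₓ F₁(U) = src` with initial data `V₀`
(both in primitive variables): finitely many `C¹` curves `x = s i t` issue from the origin; in each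
open sector between two neighbouring curves `V` is differentiable, satisfies the balance laws, and
its derivative extends continuously to the closure of the sector (the origin included). Nothing is
prescribed about the number or the speeds of the curves, across which the derivatives of `V` may
jump. -/
structure IsSolutionOn (Γ : ℝ) (src : Fin 4 → ℝ) (V₀ : ℝ → Fin 4 → ℝ) (V : ℝ × ℝ → Fin 4 → ℝ)
    (T δ : ℝ) {n : ℕ} (s : Fin n → ℝ → ℝ) : Prop where
  admissible : ∀ z ∈ spaceTime T δ, Admissible (V z)
  continuousOn : ContinuousOn V (spaceTime T δ)
  initial : ∀ x ∈ Ioo (-δ) δ, V (0, x) = V₀ x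
  curve_contDiffOn : ∀ i, ContDiffOn ℝ 1 (s i) (Ico 0 T)
  curve_zero : ∀ i, s i 0 = 0
  curve_strictMono : ∀ t ∈ Ioo 0 T, StrictMono fun i => s i t
  piecewise_C1 : ∀ k ≤ n, ∃ G : ℝ × ℝ → (ℝ × ℝ →L[ℝ] (Fin 4 → ℝ)),
    ContinuousOn G (closure (sector T δ s k) ∩ spaceTime T δ) ∧
    ∀ z ∈ sector T δ s k, HasFDerivAt V (G z) z
  balance : ∀ k ≤ n, ∀ z ∈ sector T δ s k, ∀ j : Fin 4,
    deriv (fun t => consVec Γ (V (t, z.2)) j) z.1 +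
      deriv (fun x => fluxX Γ (V (z.1, x)) j) z.2 = src j

/-- `V` is, near the origin, a continuous piecewise `C¹` solution of the (quasi one-dimensional)
generalized Riemann problem with source `src` and initial data `V₀`. -/
def IsLocalSolution (Γ : ℝ) (src : Fin 4 → ℝ) (V₀ : ℝ → Fin 4 → ℝ)
    (V : ℝ × ℝ → Fin 4 → ℝ) : Prop :=
  ∃ T > 0, ∃ δ > 0, ∃ (n : ℕ) (s : Fin n → ℝ → ℝ), IsSolutionOn Γ src V₀ V T δ s

/-- `a` is the limiting value `(∂Vⱼ/∂t)_*`, the limit of `∂Vⱼ/∂t (t, 0)` as `t → 0+`; the time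
derivative is required to exist at `(t, 0)` for all small `t > 0`. -/
def HasLimitTimeDeriv (V : ℝ × ℝ → Fin 4 → ℝ) (j : Fin 4) (a : ℝ) : Prop :=
  (∀ᶠ t in 𝓝[>] (0 : ℝ), DifferentiableAt ℝ (fun τ => V (τ, 0) j) t) ∧
    Tendsto (fun t => deriv (fun τ => V (τ, 0) j) t) (𝓝[>] 0) (𝓝 a)

/-! ### Coefficients -/

/-- `c_s² = Γ p / (ρ h)`. -/
def soundSq (Γ : ℝ) (q : Fin 4 → ℝ) : ℝ := Γ * pres q / (rho q * enthalpy Γ q)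

/-- `c_s`. -/
def sound (Γ : ℝ) (q : Fin 4 → ℝ) : ℝ := Real.sqrt (soundSq Γ q)

/-- `H = 1 - u² - v² c_s²`. -/
def capH (Γ : ℝ) (q : Fin 4 → ℝ) : ℝ := 1 - velX q ^ 2 - velY q ^ 2 * soundSq Γ q

/-- `1 - (u² + v²) c_s²`. -/
def den (Γ : ℝ) (q : Fin 4 → ℝ) : ℝ := 1 - (velX q ^ 2 + velY q ^ 2) * soundSq Γ q

/-- Acoustic eigenvalue `λ₁`. -/
def lam1 (Γ : ℝ) (q : Fin 4 → ℝ) : ℝ :=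
  (velX q * (1 - soundSq Γ q) - sound Γ q * (lorentz q)⁻¹ * Real.sqrt (capH Γ q)) / den Γ q

/-- Acoustic eigenvalue `λ₄`. -/
def lam4 (Γ : ℝ) (q : Fin 4 → ℝ) : ℝ :=
  (velX q * (1 - soundSq Γ q) + sound Γ q * (lorentz q)⁻¹ * Real.sqrt (capH Γ q)) / den Γ q

/-- `Φ = √H / (ρ h c_s W)`. -/
def capPhi (Γ : ℝ) (q : Fin 4 → ℝ) : ℝ :=
  Real.sqrt (capH Γ q) / (rho q * enthalpy Γ q * sound Γ q * lorentz q)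

/-- `M = u - (λ₄ + λ₁) / 2`. -/
def coefM (Γ : ℝ) (q : Fin 4 → ℝ) : ℝ := velX q - (lam4 Γ q + lam1 Γ q) / 2

/-- `N_u = (λ₄ - λ₁) / 2 * Φ`. -/
def coefNu (Γ : ℝ) (q : Fin 4 → ℝ) : ℝ := (lam4 Γ q - lam1 Γ q) / 2 * capPhi Γ q

/-- `N_p = (λ₄ - λ₁) / 2 * Φ⁻¹`. -/
def coefNp (Γ : ℝ) (q : Fin 4 → ℝ) : ℝ := (lam4 Γ q - lam1 Γ q) / 2 * (capPhi Γ q)⁻¹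

/-- Pressure component `C₄` of the source in primitive variables; `src = (h₁, h₂, h₃, h₄)`. -/
def srcP (Γ : ℝ) (src q : Fin 4 → ℝ) : ℝ :=
  1 / den Γ q *
    (src 3 * (Γ - 1 + (velX q ^ 2 + velY q ^ 2) * soundSq Γ q)
      - (Γ - 1) / lorentz q * src 0
      - (soundSq Γ q + Γ - 1) * (velX q * src 1 + velY q * src 2))

/-- Normal-velocity component `C₂` of the source in primitive variables. -/
def srcU (Γ : ℝ) (src q : Fin 4 → ℝ) : ℝ :=
  1 / (rho q * enthalpy Γ q * lorentz q ^ 2) *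
    (src 1 - velX q * src 3 - velX q * srcP Γ src q)

/-- Source `B₃` of the entropy equation `T (∂ₜ S + u ∂ₓ S) = B₃`. -/
def coefB3 (Γ : ℝ) (src q : Fin 4 → ℝ) : ℝ :=
  1 / rho q *
    (src 3 - velX q * src 1 - velY q * src 2 - enthalpy Γ q / lorentz q * src 0)

/-- Source `B₄` of the equation `∂ₜ 𝒱 + u ∂ₓ 𝒱 = B₄` for `𝒱 = h v W`. -/
def coefB4 (Γ : ℝ) (src q : Fin 4 → ℝ) : ℝ :=
  -(enthalpy Γ q * velY q / rho q) * src 0 + 1 / (rho q * lorentz q) * src 2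

/-- The differential `dh = Γ / (Γ - 1) * (dp / ρ - p / ρ² dρ)` of the enthalpy. -/
def dEnthalpy (Γ : ℝ) (q : Fin 4 → ℝ) (dρ dp : ℝ) : ℝ :=
  Γ / (Γ - 1) * (1 / rho q * dp - pres q / rho q ^ 2 * dρ)

/-- `∂ₓ 𝒱 = W v ∂ₓh + h v W³ u ∂ₓu + h W (v² W² + 1) ∂ₓv` at the state `q` with slope `q'`. -/
def slopeTangential (Γ : ℝ) (q q' : Fin 4 → ℝ) : ℝ :=
  lorentz q * velY q * dEnthalpy Γ q (rho q') (pres q')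
    + enthalpy Γ q * velY q * lorentz q ^ 3 * velX q * velX q'
    + enthalpy Γ q * lorentz q * (velY q ^ 2 * lorentz q ^ 2 + 1) * velY q'

/-- The upwinded value of `(∂ρ/∂t)_*`: `pt` is `(∂p/∂t)_*`, and `q'` is the slope on the side the
fluid comes from. -/
def upwindRho (Γ : ℝ) (src q q' : Fin 4 → ℝ) (pt : ℝ) : ℝ :=
  1 / (enthalpy Γ q * soundSq Γ q) *
    (pt + velX q * (pres q' - soundSq Γ q * enthalpy Γ q * rho q')
      - (Γ - 1) * rho q * coefB3 Γ src q)

/-- The upwinded value of `(∂v/∂t)_*`: `ρt`, `ut`, `pt` are the limiting time derivatives of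
`ρ`, `u`, `p`, and `q'` is the slope on the side the fluid comes from. -/
def upwindV (Γ : ℝ) (src q q' : Fin 4 → ℝ) (ρt ut pt : ℝ) : ℝ :=
  -1 / (enthalpy Γ q * lorentz q * (velY q ^ 2 * lorentz q ^ 2 + 1)) *
    (lorentz q * velY q * dEnthalpy Γ q ρt pt
      + enthalpy Γ q * velY q * lorentz q ^ 3 * velX q * ut
      - coefB4 Γ src q
      + velX q * slopeTangential Γ q q')

end RHD

end

open RHD

namespace RHD

/-! ### Positivity of the coefficients -/

section Algebra

variable {Γ : ℝ} {q : Fin 4 → ℝ}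

/-! The derivatives of `V` may jump across each curve, but `V` is continuous, so the derivative
along the curve agrees on both sides. If the slope jumps by `b` across a curve of speed `σ`, the
time derivative therefore jumps by `-σ • b`, and subtracting the two linearised balance laws makes
`b` an eigenvector for the speed `σ` (`IsJump`). In characteristic form the law is four transport
equations: `u + Φ p` (speed `λ₄`), `u - Φ p` (speed `λ₁`), the entropy combination `p - c_s² h ρ`
and the tangential quantity `h v W` (both speed `u`), with coefficients frozen at the state. Hence
each characteristic combination of slopes can jump only across a curve that moves with its own
speed.

At the origin every sector, even a cusp between tangent curves, has a limiting slope and time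
derivative. The outermost slopes are the prescribed `V'_L` and `V'_R` (`slope_left`, `slope_right`),
and consecutive ones differ by jumps whose speeds are the initial speeds of the curves
(`isJump_origin`). Call a sector central if the curves on its left have initial speed `≤ 0` and
those on its right `≥ 0`. As `λ₁ < 0 < λ₄`, its `u + Φ p` slope is that of the left datum and its `u
- Φ p` slope that of the right datum; for `u ≠ 0` the two contact combinations come from the upwind
side. These data and the balance law determine the time derivatives, with the same result in every
central sector.

It remains to return to the line `x = 0`, which may change sector infinitely often as `t → 0+`. At
small times it meets only closures of central sectors, of which there are finitely many, so the
common value is the limit (`hasLimitTimeDeriv`). If a curve meets the line at arbitrarily small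
times, its initial speed is `0`. Its speed then eventually differs from `λ₁` and `λ₄`, and from `u`
when `u ≠ 0`, so the relevant slopes do not jump and the time derivative exists at the crossing too
(`eventually_jump`). -/

theorem enthalpy_mul (hΓ : 1 < Γ) (hq : Admissible q) :
    (Γ - 1) * (rho q * enthalpy Γ q) = (Γ - 1) * rho q + Γ * pres q := by
  have h1 : Γ - 1 ≠ 0 := by linarith
  have h2 : rho q ≠ 0 := hq.1.ne'
  unfold enthalpy internalEnergy
  field_simp
  ring

theorem enthalpy_pos (hΓ : 1 < Γ) (hq : Admissible q) : 0 < enthalpy Γ q := by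
  obtain ⟨h1, h2, -⟩ := hq
  have : 0 < Γ - 1 := by linarith
  unfold enthalpy internalEnergy
  positivity

theorem lorentz_pos (hq : Admissible q) : 0 < lorentz q := by
  have : 0 < 1 - (velX q ^ 2 + velY q ^ 2) := by linarith [hq.2.2]
  unfold lorentz
  positivity

theorem lorentz_sq_mul (hq : Admissible q) :
    lorentz q ^ 2 * (1 - velX q ^ 2 - velY q ^ 2) = 1 := by
  have : 0 < 1 - (velX q ^ 2 + velY q ^ 2) := by linarith [hq.2.2]
  unfold lorentz
  rw [div_pow, Real.sq_sqrt this.le]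
  field_simp
  ring

theorem soundSq_pos (hΓ : 1 < Γ) (hq : Admissible q) : 0 < soundSq Γ q := by
  have h1 := enthalpy_pos hΓ hq
  obtain ⟨h2, h3, -⟩ := hq
  unfold soundSq
  positivity

theorem soundSq_mul (hΓ : 1 < Γ) (hq : Admissible q) :
    soundSq Γ q * (rho q * enthalpy Γ q) = Γ * pres q :=
  div_mul_cancel₀ _ (mul_pos hq.1 (enthalpy_pos hΓ hq)).ne'

/-- By the `Γ`-law, `Γ p = (Γ - 1) ρ h - (Γ - 1) ρ < (Γ - 1) ρ h`, so `c_s² < Γ - 1 ≤ 1`. Subluminal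
sound is what makes `den` and `capH` positive. -/
theorem soundSq_lt_one (hΓ : 1 < Γ) (hΓ' : Γ ≤ 2) (hq : Admissible q) : soundSq Γ q < 1 := by
  have h1 := enthalpy_pos hΓ hq
  have h2 := enthalpy_mul hΓ hq
  unfold soundSq
  rw [div_lt_one (mul_pos hq.1 h1)]
  nlinarith [mul_pos hq.1 h1, mul_pos (sub_pos.2 hΓ) hq.1]

theorem den_pos (hΓ : 1 < Γ) (hΓ' : Γ ≤ 2) (hq : Admissible q) : 0 < den Γ q := by
  have h1 := soundSq_lt_one hΓ hΓ' hq
  have h2 := soundSq_pos hΓ hq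
  have h3 := hq.2.2
  unfold den
  nlinarith [sq_nonneg (velX q), sq_nonneg (velY q)]

theorem capH_pos (hΓ : 1 < Γ) (hΓ' : Γ ≤ 2) (hq : Admissible q) : 0 < capH Γ q := by
  have h1 := soundSq_lt_one hΓ hΓ' hq
  have h3 := hq.2.2
  unfold capH
  nlinarith [sq_nonneg (velX q), sq_nonneg (velY q)]

theorem sound_pos (hΓ : 1 < Γ) (hq : Admissible q) : 0 < sound Γ q :=
  Real.sqrt_pos.2 (soundSq_pos hΓ hq)

theorem capPhi_pos (hΓ : 1 < Γ) (hΓ' : Γ ≤ 2) (hq : Admissible q) : 0 < capPhi Γ q := by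
  have h1 := enthalpy_pos hΓ hq
  have h2 := sound_pos hΓ hq
  have h3 := lorentz_pos hq
  have h4 := Real.sqrt_pos.2 (capH_pos hΓ hΓ' hq)
  have h5 := hq.1
  unfold capPhi
  positivity

/-! ### Rational forms of the acoustic coefficients -/

theorem lam1_add_lam4 : (lam4 Γ q + lam1 Γ q) / 2 = velX q * (1 - soundSq Γ q) / den Γ q := by
  unfold lam1 lam4
  ring

theorem lam4_sub_lam1 : (lam4 Γ q - lam1 Γ q) / 2
    = sound Γ q * (lorentz q)⁻¹ * √(capH Γ q) / den Γ q := by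
  unfold lam1 lam4
  ring

/-- The square roots in `λ₄ - λ₁` and in `Φ` cancel, so the equations for `u` and `p` can be checked
as rational identities. -/
theorem coefNp_eq (hΓ : 1 < Γ) (hΓ' : Γ ≤ 2) (hq : Admissible q) :
    coefNp Γ q = rho q * enthalpy Γ q * soundSq Γ q / den Γ q := by
  have h1 := (enthalpy_pos hΓ hq).ne'
  have h2 := (sound_pos hΓ hq).ne'
  have h3 := (lorentz_pos hq).ne'
  have h4 := (Real.sqrt_pos.2 (capH_pos hΓ hΓ' hq)).ne'
  have h5 := hq.1.ne'
  have h6 := (den_pos hΓ hΓ' hq).ne'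
  have h7 : sound Γ q ^ 2 = soundSq Γ q := Real.sq_sqrt (soundSq_pos hΓ hq).le
  rw [coefNp, lam4_sub_lam1, ← h7]
  unfold capPhi
  field_simp

theorem coefNu_eq (hΓ : 1 < Γ) (hΓ' : Γ ≤ 2) (hq : Admissible q) :
    coefNu Γ q = capH Γ q / (rho q * enthalpy Γ q * lorentz q ^ 2 * den Γ q) := by
  have h1 := (enthalpy_pos hΓ hq).ne'
  have h2 := (sound_pos hΓ hq).ne'
  have h3 := (lorentz_pos hq).ne'
  have h5 := hq.1.ne'
  have h6 := (den_pos hΓ hΓ' hq).ne'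
  have h7 : √(capH Γ q) ^ 2 = capH Γ q := Real.sq_sqrt (capH_pos hΓ hΓ' hq).le
  rw [coefNu, lam4_sub_lam1]
  -- The first occurrence of `capH` stands under the square root; the second is the numerator on the
  -- right.
  nth_rw 2 [← h7]
  unfold capPhi
  field_simp

/-! ### The linearised balance law -/

/-- Differential of the Lorentz factor. -/
noncomputable def dLorentz (q a : Fin 4 → ℝ) : ℝ :=
  lorentz q ^ 3 * (velX q * velX a + velY q * velY a)

/-- Differential of `D`. -/
noncomputable def dMass (q a : Fin 4 → ℝ) : ℝ := rho a * lorentz q + rho q * dLorentz q a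

/-- Differential of `D h W`. -/
noncomputable def dMomentum (Γ : ℝ) (q a : Fin 4 → ℝ) : ℝ :=
  (dMass q a * enthalpy Γ q + rho q * lorentz q * dEnthalpy Γ q (rho a) (pres a)) * lorentz q
    + rho q * lorentz q * enthalpy Γ q * dLorentz q a

/-- Differential of `consVec`. -/
noncomputable def dCons (Γ : ℝ) (q a : Fin 4 → ℝ) : Fin 4 → ℝ :=
  ![dMass q a,
    dMomentum Γ q a * velX q + rho q * lorentz q * enthalpy Γ q * lorentz q * velX a,
    dMomentum Γ q a * velY q + rho q * lorentz q * enthalpy Γ q * lorentz q * velY a,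
    dMomentum Γ q a - pres a]

/-- Differential of `fluxX`. -/
noncomputable def dFlux (Γ : ℝ) (q b : Fin 4 → ℝ) : Fin 4 → ℝ :=
  ![dCons Γ q b 0 * velX q + consVec Γ q 0 * velX b,
    velX b * consVec Γ q 1 + velX q * dCons Γ q b 1 + pres b,
    velX b * consVec Γ q 2 + velX q * dCons Γ q b 2,
    dCons Γ q b 1]

/-- The balance law, linearised at `q`, for the time derivative `a` and the slope `b`. -/
def LinBalance (Γ : ℝ) (src q a b : Fin 4 → ℝ) : Prop :=
  ∀ j, dCons Γ q a j + dFlux Γ q b j = src j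

theorem dCons_sub (a a' : Fin 4 → ℝ) (j : Fin 4) :
    dCons Γ q (a - a') j = dCons Γ q a j - dCons Γ q a' j := by
  fin_cases j <;>
    simp [dCons, dMomentum, dMass, dLorentz, dEnthalpy, rho, velX, velY, pres] <;> ring

theorem dFlux_sub (a a' : Fin 4 → ℝ) (j : Fin 4) :
    dFlux Γ q (a - a') j = dFlux Γ q a j - dFlux Γ q a' j := by
  fin_cases j <;>
    simp [dFlux, dCons_sub, velX, pres] <;> ring

theorem LinBalance.sub {src a b a' b' : Fin 4 → ℝ} (h : LinBalance Γ src q a b)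
    (h' : LinBalance Γ src q a' b') : LinBalance Γ 0 q (a - a') (b - b') := fun j => by
  rw [dCons_sub, dFlux_sub, Pi.zero_apply]
  linarith [h j, h' j]

/-! ### The balance law in primitive variables -/

section Primitive

variable {src a b : Fin 4 → ℝ}

theorem LinBalance.mass (h : LinBalance Γ src q a b) :
    lorentz q * (rho a + velX q * rho b)
      + rho q * (dLorentz q a + velX q * dLorentz q b) + rho q * lorentz q * velX b = src 0 := by
  have := h 0
  simp [dCons, dFlux, consVec, dMass] at this
  linear_combination this

/-- With `Q = D h W`, one has `m₁ = Q u` and `E = Q - p`, and the flux of `E` is `Q u`. Subtracting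
`u` times the energy equation removes every derivative of `Q`. -/
theorem LinBalance.momentumX (h : LinBalance Γ src q a b) :
    rho q * enthalpy Γ q * lorentz q ^ 2 * (velX a + velX q * velX b) + pres b
      + velX q * pres a = src 1 - velX q * src 3 := by
  have h1 := h 1
  have h3 := h 3
  simp [dCons, dFlux, consVec] at h1 h3
  linear_combination h1 - velX q * h3

theorem LinBalance.momentumY (h : LinBalance Γ src q a b) :
    rho q * enthalpy Γ q * lorentz q ^ 2 * (velY a + velX q * velY b)
      + velY q * pres a = src 2 - velY q * src 3 := by
  have h1 := h 2
  have h3 := h 3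
  simp [dCons, dFlux, consVec] at h1 h3
  linear_combination h1 - velY q * h3

/-- This is the first law: `ρ dh - dp` along the flow, obtained from the energy equation minus
velocity times momentum minus `h / W` times mass. The derivatives of the velocity cancel because `W²
(1 - u² - v²) = 1`. -/
theorem LinBalance.entropy_aux (hq : Admissible q) (h : LinBalance Γ src q a b) :
    rho q * (dEnthalpy Γ q (rho a) (pres a) + velX q * dEnthalpy Γ q (rho b) (pres b))
      - (pres a + velX q * pres b) = rho q * coefB3 Γ src q := by
  have h0 := h 0
  have h1 := h 1
  have h2 := h 2
  have h3 := h 3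
  have hW := lorentz_sq_mul hq
  have hW0 := (lorentz_pos hq).ne'
  have hρ := hq.1.ne'
  -- Multiplying by `W` clears the denominator of `h / W`, which leaves a polynomial identity modulo
  -- `hW`.
  have key : lorentz q *
      (rho q * (dEnthalpy Γ q (rho a) (pres a) + velX q * dEnthalpy Γ q (rho b) (pres b))
      - (pres a + velX q * pres b))
      = lorentz q * (src 3 - velX q * src 1 - velY q * src 2) - enthalpy Γ q * src 0 := by
    simp [dCons, dFlux, consVec, dMass, dMomentum, dLorentz] at h0 h1 h2 h3
    rw [← h0, ← h1, ← h2, ← h3]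
    generalize dEnthalpy Γ q (rho a) (pres a) = da
    generalize dEnthalpy Γ q (rho b) (pres b) = db
    generalize enthalpy Γ q = h at *
    generalize lorentz q = W at *
    linear_combination (-(rho q * W * (da + velX q * db))
      - rho q * h * W ^ 3 * (velX q * (velX a + velX q * velX b) + velY q * (velY a + velX q * velY b))
      - h * (W * (rho a + velX q * rho b)
      + rho q * W ^ 3 * (velX q * (velX a + velX q * velX b) + velY q * (velY a + velX q * velY b))
        + rho q * W * velX b)) * hW
  unfold coefB3
  field_simp
  linear_combination key

theorem LinBalance.entropy (hΓ : 1 < Γ) (hq : Admissible q) (h : LinBalance Γ src q a b) :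
    pres a + velX q * pres b - soundSq Γ q * enthalpy Γ q * (rho a + velX q * rho b)
      = (Γ - 1) * rho q * coefB3 Γ src q := by
  have h1 := h.entropy_aux hq
  have hρ := hq.1.ne'
  have hg : Γ - 1 ≠ 0 := by linarith
  have h2 : soundSq Γ q * enthalpy Γ q = Γ * pres q / rho q := by
    rw [eq_div_iff hρ, ← soundSq_mul hΓ hq]; ring
  rw [mul_assoc (Γ - 1), ← h1, h2]
  unfold dEnthalpy
  field_simp
  ring

/-- Since `m₂ = D (h v W)` is carried by the mass flux, subtracting `h v W` times the mass equation
and dividing by `D` leaves the transport equation for `h v W`. -/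
theorem LinBalance.tangential (hq : Admissible q) (h : LinBalance Γ src q a b) :
    slopeTangential Γ q a + velX q * slopeTangential Γ q b = coefB4 Γ src q := by
  have h0 := h 0
  have h2 := h 2
  have hW0 := (lorentz_pos hq).ne'
  have hρ := hq.1.ne'
  simp [dCons, dFlux, consVec, dMass, dMomentum, dLorentz] at h0 h2
  unfold slopeTangential coefB4
  rw [← h0, ← h2]
  field_simp
  ring

/-- In the entropy equation, the mass equation eliminates the derivatives of `ρ` at the cost of
those of `W`, and the two momentum equations eliminate the latter. Only the derivatives of `p` and
the slope of `u` remain. -/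
theorem LinBalance.pressure (hΓ : 1 < Γ) (hΓ' : Γ ≤ 2) (hq : Admissible q)
    (h : LinBalance Γ src q a b) :
    pres a + (lam4 Γ q + lam1 Γ q) / 2 * pres b + coefNp Γ q * velX b = srcP Γ src q := by
  have h0 := h.mass
  have h1 := h.momentumX
  have h2 := h.momentumY
  have h3 := h.entropy hΓ hq
  have hW0 := (lorentz_pos hq).ne'
  have hρ := hq.1.ne'
  have hd := (den_pos hΓ hΓ' hq).ne'
  have hc := soundSq_mul hΓ hq
  have hh := enthalpy_mul hΓ hq
  -- The `Γ`-law in the form that reduces the coefficient of `src 0` to that in `srcP`.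
  have hch : enthalpy Γ q * (soundSq Γ q - (Γ - 1)) = - (Γ - 1) := by
    apply mul_left_cancel₀ hρ
    linear_combination hc - hh
  have hB : rho q * coefB3 Γ src q
      = src 3 - velX q * src 1 - velY q * src 2 - enthalpy Γ q / lorentz q * src 0 := by
    unfold coefB3
    field_simp
  rw [lam1_add_lam4, coefNp_eq hΓ hΓ' hq, srcP]
  field_simp
  rw [mul_assoc (Γ - 1), hB] at h3
  field_simp at h3
  unfold dLorentz at h0
  unfold den
  linear_combination h3 + soundSq Γ q * enthalpy Γ q * h0
    - lorentz q * soundSq Γ q * (velX q * h1 + velY q * h2) + src 0 * hch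

theorem LinBalance.velocity (hΓ : 1 < Γ) (hΓ' : Γ ≤ 2) (hq : Admissible q)
    (h : LinBalance Γ src q a b) :
    velX a + (lam4 Γ q + lam1 Γ q) / 2 * velX b + coefNu Γ q * pres b = srcU Γ src q := by
  have h1 := h.momentumX
  have h2 := h.pressure hΓ hΓ' hq
  have hW := lorentz_sq_mul hq
  have hW0 := (lorentz_pos hq).ne'
  have hρ := hq.1.ne'
  have hh := (enthalpy_pos hΓ hq).ne'
  have hd := (den_pos hΓ hΓ' hq).ne'
  rw [lam1_add_lam4, coefNp_eq hΓ hΓ' hq] at h2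
  rw [lam1_add_lam4, coefNu_eq hΓ hΓ' hq, srcU, ← h2]
  field_simp
  unfold den capH
  unfold den at hd
  linear_combination (1 - (velX q ^ 2 + velY q ^ 2) * soundSq Γ q) * h1
    - rho q * enthalpy Γ q * velX q * soundSq Γ q * velX b * hW

end Primitive

end Algebra

/-! ### Characteristic relations -/

section Characteristic

variable {Γ : ℝ} {q src a b : Fin 4 → ℝ}

/-- Add `Φ` times the pressure equation to the velocity equation: `N_u = Φ (λ₄ - λ₁) / 2` and `Φ N_p
= (λ₄ - λ₁) / 2`, so the mean speed `(λ₄ + λ₁) / 2` is shifted to `λ₄`. Subtracting instead shifts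
it to `λ₁`. -/
theorem LinBalance.fast (hΓ : 1 < Γ) (hΓ' : Γ ≤ 2) (hq : Admissible q)
    (h : LinBalance Γ src q a b) :
    velX a + capPhi Γ q * pres a + lam4 Γ q * (velX b + capPhi Γ q * pres b)
      = srcU Γ src q + capPhi Γ q * srcP Γ src q := by
  rw [← h.velocity hΓ hΓ' hq, ← h.pressure hΓ hΓ' hq, coefNu, coefNp]
  have := (capPhi_pos hΓ hΓ' hq).ne'
  field_simp
  ring

theorem LinBalance.slow (hΓ : 1 < Γ) (hΓ' : Γ ≤ 2) (hq : Admissible q)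
    (h : LinBalance Γ src q a b) :
    velX a - capPhi Γ q * pres a + lam1 Γ q * (velX b - capPhi Γ q * pres b)
      = srcU Γ src q - capPhi Γ q * srcP Γ src q := by
  rw [← h.velocity hΓ hΓ' hq, ← h.pressure hΓ hΓ' hq, coefNu, coefNp]
  have := (capPhi_pos hΓ hΓ' hq).ne'
  field_simp
  ring

/-- A jump `b` of the slope across a curve of speed `σ` in a continuous solution. -/
def IsJump (Γ : ℝ) (q : Fin 4 → ℝ) (σ : ℝ) (b : Fin 4 → ℝ) : Prop :=
  LinBalance Γ 0 q (-σ • b) b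

variable {σ : ℝ}

theorem IsJump.fast_eq_zero (hΓ : 1 < Γ) (hΓ' : Γ ≤ 2) (hq : Admissible q)
    (h : IsJump Γ q σ b) (hσ : σ ≠ lam4 Γ q) : velX b + capPhi Γ q * pres b = 0 := by
  have := LinBalance.fast hΓ hΓ' hq h
  simp [srcU, srcP, velX, pres] at this
  refine (mul_eq_zero.1 (?_ : (lam4 Γ q - σ) * _ = 0)).resolve_left (sub_ne_zero.2 hσ.symm)
  unfold velX pres
  linear_combination this

theorem IsJump.slow_eq_zero (hΓ : 1 < Γ) (hΓ' : Γ ≤ 2) (hq : Admissible q)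
    (h : IsJump Γ q σ b) (hσ : σ ≠ lam1 Γ q) : velX b - capPhi Γ q * pres b = 0 := by
  have := LinBalance.slow hΓ hΓ' hq h
  simp [srcU, srcP, velX, pres] at this
  refine (mul_eq_zero.1 (?_ : (lam1 Γ q - σ) * _ = 0)).resolve_left (sub_ne_zero.2 hσ.symm)
  unfold velX pres
  linear_combination this

theorem IsJump.entropy_eq_zero (hΓ : 1 < Γ) (hq : Admissible q)
    (h : IsJump Γ q σ b) (hσ : σ ≠ velX q) :
    pres b - soundSq Γ q * enthalpy Γ q * rho b = 0 := by
  have := LinBalance.entropy hΓ hq h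
  simp [coefB3, rho, pres] at this
  refine (mul_eq_zero.1 (?_ : (velX q - σ) * _ = 0)).resolve_left (sub_ne_zero.2 hσ.symm)
  unfold rho pres
  linear_combination this

theorem IsJump.tangential_eq_zero (hq : Admissible q)
    (h : IsJump Γ q σ b) (hσ : σ ≠ velX q) : slopeTangential Γ q b = 0 := by
  have := LinBalance.tangential hq h
  refine (mul_eq_zero.1 (?_ : (velX q - σ) * _ = 0)).resolve_left (sub_ne_zero.2 hσ.symm)
  simp [coefB4] at this
  rw [← this]
  simp [slopeTangential, dEnthalpy, rho, velX, velY, pres]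
  ring

theorem IsJump.velX_pres_eq_zero (hΓ : 1 < Γ) (hΓ' : Γ ≤ 2) (hq : Admissible q)
    (h : IsJump Γ q σ b) (h4 : σ ≠ lam4 Γ q) (h1 : σ ≠ lam1 Γ q) :
    velX b = 0 ∧ pres b = 0 := by
  have e4 := h.fast_eq_zero hΓ hΓ' hq h4
  have e1 := h.slow_eq_zero hΓ hΓ' hq h1
  have hΦ := (capPhi_pos hΓ hΓ' hq).ne'
  have hp : pres b = 0 :=
    (mul_eq_zero.1 (by linarith : capPhi Γ q * pres b = 0)).resolve_left hΦ
  exact ⟨by simpa [hp] using e4, hp⟩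

theorem IsJump.rho_velY_eq_zero (hΓ : 1 < Γ) (hΓ' : Γ ≤ 2) (hq : Admissible q)
    (h : IsJump Γ q σ b) (h4 : σ ≠ lam4 Γ q) (h1 : σ ≠ lam1 Γ q) (hσ : σ ≠ velX q) :
    rho b = 0 ∧ velY b = 0 := by
  obtain ⟨hu, hp⟩ := h.velX_pres_eq_zero hΓ hΓ' hq h4 h1
  have e3 := h.entropy_eq_zero hΓ hq hσ
  have e2 := h.tangential_eq_zero hq hσ
  have hc := soundSq_pos hΓ hq
  have hh := enthalpy_pos hΓ hq
  have hW := lorentz_pos hq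
  have hρ : rho b = 0 :=
    (mul_eq_zero.1 (by linarith : soundSq Γ q * enthalpy Γ q * rho b = 0)).resolve_left
      (by positivity)
  refine ⟨hρ, ?_⟩
  simp only [slopeTangential, dEnthalpy, hρ, hp, hu, mul_zero, sub_zero, zero_add] at e2
  exact (mul_eq_zero.1 e2).resolve_left (by positivity)

end Characteristic

/-! ### Chain rule for the conserved variables and the flux -/

section ChainRule

variable {Γ : ℝ} {f : ℝ → Fin 4 → ℝ} {a : Fin 4 → ℝ} {t : ℝ}

theorem hasDerivAt_lorentz (hf : HasDerivAt f a t) (hq : Admissible (f t)) :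
    HasDerivAt (fun τ => lorentz (f τ)) (dLorentz (f t) a) t := by
  have h := hasDerivAt_pi.1 hf
  have hpos : 0 < 1 - (velX (f t) ^ 2 + velY (f t) ^ 2) := by linarith [hq.2.2]
  have h1 : HasDerivAt (fun τ => 1 - (velX (f τ) ^ 2 + velY (f τ) ^ 2))
      (-(2 * velX (f t) * velX a + 2 * velY (f t) * velY a)) t := by
    simpa [velX, velY] using (((h 1).pow 2).add ((h 2).pow 2)).const_sub 1
  have h2 := (h1.sqrt hpos.ne').inv (Real.sqrt_pos.2 hpos).ne'
  have e : (fun τ => lorentz (f τ)) = (fun τ => √(1 - (velX (f τ) ^ 2 + velY (f τ) ^ 2)))⁻¹ := by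
    funext τ; simp [lorentz]
  rw [e]
  refine h2.congr_deriv ?_
  have := (Real.sqrt_pos.2 hpos).ne'
  unfold dLorentz lorentz
  field_simp

theorem hasDerivAt_enthalpy (hΓ : 1 < Γ) (hf : HasDerivAt f a t) (hq : Admissible (f t)) :
    HasDerivAt (fun τ => enthalpy Γ (f τ)) (dEnthalpy Γ (f t) (rho a) (pres a)) t := by
  have h := hasDerivAt_pi.1 hf
  have hρ : f t 0 ≠ 0 := hq.1.ne'
  have hg : Γ - 1 ≠ 0 := by linarith
  have h1 := ((((h 3).div ((h 0).const_mul (Γ - 1)) (mul_ne_zero hg hρ)).const_add 1).add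
    ((h 3).div (h 0) hρ))
  refine HasDerivAt.congr_deriv h1 ?_
  simp only [dEnthalpy, rho, pres]
  field_simp
  ring

theorem hasDerivAt_consVec (hΓ : 1 < Γ) (hf : HasDerivAt f a t) (hq : Admissible (f t))
    (j : Fin 4) : HasDerivAt (fun τ => consVec Γ (f τ) j) (dCons Γ (f t) a j) t := by
  have h := hasDerivAt_pi.1 hf
  have hD := (h 0).mul (hasDerivAt_lorentz hf hq)
  have hM := (hD.mul (hasDerivAt_enthalpy hΓ hf hq)).mul (hasDerivAt_lorentz hf hq)
  fin_cases j
  · exact hD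
  · exact hM.mul (h 1)
  · exact hM.mul (h 2)
  · exact hM.sub (h 3)

theorem hasDerivAt_fluxX (hΓ : 1 < Γ) (hf : HasDerivAt f a t) (hq : Admissible (f t))
    (j : Fin 4) : HasDerivAt (fun τ => fluxX Γ (f τ) j) (dFlux Γ (f t) a j) t := by
  have h := hasDerivAt_pi.1 hf
  have hU := hasDerivAt_consVec hΓ hf hq
  fin_cases j
  · exact (hU 0).mul (h 1)
  · exact ((h 1).mul (hU 1)).add (h 3)
  · exact ((h 1).mul (hU 2))
  · exact hU 1

end ChainRule

/-! ### Continuity of the coefficients -/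

section Continuity

variable {Γ : ℝ} {X : Type*} {l : Filter X} {f g : X → Fin 4 → ℝ} {q a : Fin 4 → ℝ}

theorem tendsto_lorentz (hf : Tendsto f l (𝓝 q)) (hq : Admissible q) :
    Tendsto (fun x => lorentz (f x)) l (𝓝 (lorentz q)) := by
  have h := tendsto_pi_nhds.1 hf
  have hpos : 0 < 1 - (velX q ^ 2 + velY q ^ 2) := by linarith [hq.2.2]
  exact tendsto_const_nhds.div (((tendsto_const_nhds.sub (((h 1).pow 2).add ((h 2).pow 2)))).sqrt)
    (Real.sqrt_pos.2 hpos).ne'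

theorem tendsto_enthalpy (hΓ : 1 < Γ) (hf : Tendsto f l (𝓝 q)) (hq : Admissible q) :
    Tendsto (fun x => enthalpy Γ (f x)) l (𝓝 (enthalpy Γ q)) := by
  have h := tendsto_pi_nhds.1 hf
  have hρ : q 0 ≠ 0 := hq.1.ne'
  have hg : Γ - 1 ≠ 0 := by linarith
  exact (((h 3).div ((h 0).const_mul (Γ - 1)) (mul_ne_zero hg hρ)).const_add 1).add
    ((h 3).div (h 0) hρ)

theorem tendsto_dEnthalpy (hf : Tendsto f l (𝓝 q)) (hg : Tendsto g l (𝓝 a))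
    (hq : Admissible q) :
    Tendsto (fun x => dEnthalpy Γ (f x) (rho (g x)) (pres (g x))) l
      (𝓝 (dEnthalpy Γ q (rho a) (pres a))) := by
  have h := tendsto_pi_nhds.1 hf
  have h' := tendsto_pi_nhds.1 hg
  have hρ : q 0 ≠ 0 := hq.1.ne'
  exact (((tendsto_const_nhds.div (h 0) hρ).mul (h' 3)).sub
    (((h 3).div ((h 0).pow 2) (pow_ne_zero 2 hρ)).mul (h' 0))).const_mul _

theorem tendsto_dCons (hΓ : 1 < Γ) (hf : Tendsto f l (𝓝 q)) (hg : Tendsto g l (𝓝 a))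
    (hq : Admissible q) (j : Fin 4) :
    Tendsto (fun x => dCons Γ (f x) (g x) j) l (𝓝 (dCons Γ q a j)) := by
  have h := tendsto_pi_nhds.1 hf
  have h' := tendsto_pi_nhds.1 hg
  have hW := tendsto_lorentz hf hq
  have hh := tendsto_enthalpy hΓ hf hq
  have hdW : Tendsto (fun x => dLorentz (f x) (g x)) l (𝓝 (dLorentz q a)) :=
    (hW.pow 3).mul (((h 1).mul (h' 1)).add ((h 2).mul (h' 2)))
  have hdD : Tendsto (fun x => dMass (f x) (g x)) l (𝓝 (dMass q a)) :=
    ((h' 0).mul hW).add ((h 0).mul hdW)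
  have hD := (h 0).mul hW
  have hdM : Tendsto (fun x => dMomentum Γ (f x) (g x)) l (𝓝 (dMomentum Γ q a)) :=
    (((hdD.mul hh).add (hD.mul (tendsto_dEnthalpy hf hg hq))).mul hW).add ((hD.mul hh).mul hdW)
  fin_cases j
  · exact hdD
  · exact (hdM.mul (h 1)).add (((hD.mul hh).mul hW).mul (h' 1))
  · exact (hdM.mul (h 2)).add (((hD.mul hh).mul hW).mul (h' 2))
  · exact hdM.sub (h' 3)

theorem tendsto_consVec (hΓ : 1 < Γ) (hf : Tendsto f l (𝓝 q))
    (hq : Admissible q) (j : Fin 4) :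
    Tendsto (fun x => consVec Γ (f x) j) l (𝓝 (consVec Γ q j)) := by
  have h := tendsto_pi_nhds.1 hf
  have hW := tendsto_lorentz hf hq
  have hD := (h 0).mul hW
  have hM := (hD.mul (tendsto_enthalpy hΓ hf hq)).mul hW
  fin_cases j
  · exact hD
  · exact hM.mul (h 1)
  · exact hM.mul (h 2)
  · exact hM.sub (h 3)

theorem tendsto_dFlux (hΓ : 1 < Γ) (hf : Tendsto f l (𝓝 q)) (hg : Tendsto g l (𝓝 a))
    (hq : Admissible q) (j : Fin 4) :
    Tendsto (fun x => dFlux Γ (f x) (g x) j) l (𝓝 (dFlux Γ q a j)) := by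
  have h := tendsto_pi_nhds.1 hf
  have h' := tendsto_pi_nhds.1 hg
  have hU := tendsto_consVec hΓ hf hq
  have hdU := tendsto_dCons hΓ hf hg hq
  fin_cases j
  · exact ((hdU 0).mul (h 1)).add ((hU 0).mul (h' 1))
  · exact (((h' 1).mul (hU 1)).add ((h 1).mul (hdU 1))).add (h' 3)
  · exact ((h' 1).mul (hU 2)).add ((h 1).mul (hdU 2))
  · exact hdU 1

theorem tendsto_lam (hΓ : 1 < Γ) (hΓ' : Γ ≤ 2) (hf : Tendsto f l (𝓝 q)) (hq : Admissible q) :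
    Tendsto (fun x => lam1 Γ (f x)) l (𝓝 (lam1 Γ q)) ∧
      Tendsto (fun x => lam4 Γ (f x)) l (𝓝 (lam4 Γ q)) := by
  have h := tendsto_pi_nhds.1 hf
  have hW := (tendsto_lorentz hf hq).inv₀ (lorentz_pos hq).ne'
  have hc : Tendsto (fun x => soundSq Γ (f x)) l (𝓝 (soundSq Γ q)) :=
    ((h 3).const_mul Γ).div ((h 0).mul (tendsto_enthalpy hΓ hf hq))
      (mul_pos hq.1 (enthalpy_pos hΓ hq)).ne'
  have hH : Tendsto (fun x => √(capH Γ (f x))) l (𝓝 √(capH Γ q)) :=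
    ((tendsto_const_nhds.sub ((h 1).pow 2)).sub (((h 2).pow 2).mul hc)).sqrt
  have hd : Tendsto (fun x => den Γ (f x)) l (𝓝 (den Γ q)) :=
    tendsto_const_nhds.sub ((((h 1).pow 2).add ((h 2).pow 2)).mul hc)
  have hd0 := (den_pos hΓ hΓ' hq).ne'
  have h1 := (h 1).mul (hc.const_sub 1)
  have h2 := (hc.sqrt.mul hW).mul hH
  exact ⟨(h1.sub h2).div hd hd0, (h1.add h2).div hd hd0⟩

end Continuity

/-! ### One-sided differentiability along a hyperplane -/

section HalfSpace

variable {E F : Type*} [NormedAddCommGroup E] [NormedSpace ℝ E] [NormedAddCommGroup F]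
  [NormedSpace ℝ F]

theorem nhdsWithin_halfSpace_neBot (φ : E →L[ℝ] ℝ) {w z₀ : E} (hw : 0 < φ w) (h₀ : 0 ≤ φ z₀) :
    (𝓝[{z | 0 < φ z}] z₀).NeBot := by
  rw [← mem_closure_iff_nhdsWithin_neBot]
  have h1 : Tendsto (fun ε : ℝ => z₀ + ε • w) (𝓝[>] 0) (𝓝 z₀) := by
    have : Continuous fun ε : ℝ => z₀ + ε • w := by fun_prop
    simpa using (this.tendsto 0).mono_left nhdsWithin_le_nhds
  refine mem_closure_of_tendsto h1 ?_
  filter_upwards [self_mem_nhdsWithin] with ε hε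
  have : 0 < ε * φ w := mul_pos hε hw
  simpa using by linarith

/-- The mean value inequality needs a convex open set, so the half-space is cut by a small ball. The
result gives differentiability up to a curve, once straightened, and up to the line `t = 0`. -/
theorem hasFDerivWithinAt_halfSpace (φ : E →L[ℝ] ℝ) {w : E} (hw : 0 < φ w) {z₀ : E}
    {f : E → F} {f' : E → E →L[ℝ] F} {L : E →L[ℝ] F}
    (hcont : ∀ᶠ z in 𝓝[{z | 0 ≤ φ z}] z₀, ContinuousWithinAt f {z | 0 ≤ φ z} z)
    (hdiff : ∀ᶠ z in 𝓝[{z | 0 < φ z}] z₀, HasFDerivAt f (f' z) z)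
    (hlim : Tendsto f' (𝓝[{z | 0 < φ z}] z₀) (𝓝 L)) :
    HasFDerivWithinAt f L {z | 0 ≤ φ z} z₀ := by
  obtain ⟨r, hr, h⟩ := Metric.eventually_nhds_iff_ball.1
    ((eventually_nhdsWithin_iff.1 hcont).and (eventually_nhdsWithin_iff.1 hdiff))
  -- Half the radius keeps the closure of `S` inside the ball where the hypotheses hold.
  set S : Set E := Metric.ball z₀ (r / 2) ∩ {z | 0 < φ z} with hS
  have hopen : IsOpen S := Metric.isOpen_ball.inter (isOpen_lt continuous_const φ.continuous)
  have hconv : Convex ℝ S :=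
    (convex_ball _ _).inter (convex_halfSpace_gt φ.toLinearMap.isLinear 0)
  have hsub : S ⊆ {z | 0 < φ z} := inter_subset_right
  have hcl : closure S ⊆ Metric.ball z₀ r ∩ {z | 0 ≤ φ z} := by
    refine (closure_inter_subset_inter_closure _ _).trans (inter_subset_inter ?_ ?_)
    · exact Metric.closure_ball_subset_closedBall.trans
        (Metric.closedBall_subset_ball (by linarith))
    · exact closure_minimal (fun z hz => le_of_lt (mem_ofPred.1 hz))
        (isClosed_le continuous_const φ.continuous)
  have hmem : ∀ z ∈ S, HasFDerivAt f (f' z) z := fun z hz =>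
    (h z (Metric.ball_subset_ball (by linarith) hz.1)).2 hz.2
  have key : HasFDerivWithinAt f L (closure S) z₀ := by
    refine hasFDerivWithinAt_closure_of_tendsto_fderiv
      (fun z hz => (hmem z hz).differentiableAt.differentiableWithinAt) hconv hopen ?_ ?_
    · intro y hy
      exact ((h y (hcl hy).1).1 (hcl hy).2).mono fun z hz => le_of_lt (mem_ofPred.1 hz.2)
    · refine (hlim.mono_left (nhdsWithin_mono _ hsub)).congr' ?_
      filter_upwards [self_mem_nhdsWithin] with z hz using (hmem z hz).fderiv.symm
  refine key.mono_of_mem_nhdsWithin ?_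
  refine mem_nhdsWithin.2 ⟨Metric.ball z₀ (r / 2), Metric.isOpen_ball,
    Metric.mem_ball_self (by linarith), ?_⟩
  rintro z ⟨hz, hz'⟩
  have := nhdsWithin_halfSpace_neBot φ hw hz'
  rw [mem_closure_iff_nhdsWithin_neBot, hS,
    nhdsWithin_inter_of_mem (nhdsWithin_le_nhds (Metric.isOpen_ball.mem_nhds hz))]
  exact this

end HalfSpace

/-! ### The straightening of a curve -/

/-- The linear map `(t, y) ↦ (t, y + σ t)`. -/
noncomputable def shear (σ : ℝ) : ℝ × ℝ →L[ℝ] ℝ × ℝ :=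
  (ContinuousLinearMap.fst ℝ ℝ ℝ).prod
    (ContinuousLinearMap.snd ℝ ℝ ℝ + σ • ContinuousLinearMap.fst ℝ ℝ ℝ)

theorem shear_apply (σ : ℝ) (z : ℝ × ℝ) : shear σ z = (z.1, z.2 + σ * z.1) := rfl

theorem continuous_shear : Continuous shear := by
  have h : shear = fun σ => shear 0 +
      σ • (ContinuousLinearMap.inr ℝ ℝ ℝ).comp (ContinuousLinearMap.fst ℝ ℝ ℝ) := by
    funext σ
    ext <;> simp [shear]
  rw [h]
  fun_prop

theorem hasFDerivAt_straighten {c : ℝ → ℝ} {z : ℝ × ℝ} {σ : ℝ} (hc : HasDerivAt c σ z.1) :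
    HasFDerivAt (fun w : ℝ × ℝ => (w.1, w.2 + c w.1)) (shear σ) z := by
  refine hasFDerivAt_fst.prodMk (hasFDerivAt_snd.add ?_)
  exact HasDerivAt.comp_hasFDerivAt (f := Prod.fst) z hc hasFDerivAt_fst

/-! ### Derivatives on the closed sectors -/

/-- `G k` is the continuous extension to the closure of the `k`-th sector of the derivative of
`V`. -/
structure IsPieceDeriv (V : ℝ × ℝ → Fin 4 → ℝ) (T δ : ℝ) {n : ℕ} (s : Fin n → ℝ → ℝ)
    (G : ℕ → ℝ × ℝ → (ℝ × ℝ →L[ℝ] (Fin 4 → ℝ))) : Prop where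
  continuousOn : ∀ k ≤ n, ContinuousOn (G k) (closure (sector T δ s k) ∩ spaceTime T δ)
  hasFDerivAt : ∀ k ≤ n, ∀ z ∈ sector T δ s k, HasFDerivAt V (G k z) z

section Solution

variable {Γ : ℝ} {src : Fin 4 → ℝ} {V₀ : ℝ → Fin 4 → ℝ} {V : ℝ × ℝ → Fin 4 → ℝ} {T δ : ℝ}
  {n : ℕ} {s : Fin n → ℝ → ℝ} {G : ℕ → ℝ × ℝ → (ℝ × ℝ →L[ℝ] (Fin 4 → ℝ))}

theorem IsSolutionOn.exists_isPieceDeriv (S : IsSolutionOn Γ src V₀ V T δ s) :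
    ∃ G, IsPieceDeriv V T δ s G := by
  have h : ∀ k, ∃ G : ℝ × ℝ → (ℝ × ℝ →L[ℝ] (Fin 4 → ℝ)), k ≤ n →
      ContinuousOn G (closure (sector T δ s k) ∩ spaceTime T δ) ∧
      ∀ z ∈ sector T δ s k, HasFDerivAt V (G z) z := by
    intro k
    by_cases hk : k ≤ n
    · obtain ⟨G, hG⟩ := S.piecewise_C1 k hk
      exact ⟨G, fun _ => hG⟩
    -- Nothing is required for `k > n`, so any value serves.
    · exact ⟨0, fun h => absurd h hk⟩
  choose G hG using h
  exact ⟨G, fun k hk => (hG k hk).1, fun k hk => (hG k hk).2⟩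

theorem sector_subset_spaceTime (k : ℕ) : sector T δ s k ⊆ spaceTime T δ :=
  fun _ hz => ⟨Ioo_subset_Ico_self hz.1, hz.2.1⟩

theorem spaceTime_mem_nhds {z : ℝ × ℝ} (h1 : z.1 ∈ Ioo 0 T) (h2 : z.2 ∈ Ioo (-δ) δ) :
    spaceTime T δ ∈ 𝓝 z :=
  prod_mem_nhds (Ico_mem_nhds h1.1 h1.2) (Ioo_mem_nhds h2.1 h2.2)

/-! ### One-sided derivatives at a point of a curve with `t > 0` -/

section Curve

variable (S : IsSolutionOn Γ src V₀ V T δ s)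
include S

theorem IsSolutionOn.curve_continuousAt (i : Fin n) {t : ℝ} (ht : t ∈ Ioo 0 T) :
    ContinuousAt (s i) t :=
  (S.curve_contDiffOn i).continuousOn.continuousAt (Ico_mem_nhds ht.1 ht.2)

theorem IsSolutionOn.curve_hasDerivAt (i : Fin n) {t : ℝ} (ht : t ∈ Ioo 0 T) :
    HasDerivAt (s i) (deriv (s i) t) t :=
  (((S.curve_contDiffOn i).differentiableOn one_ne_zero).differentiableAt
    (Ico_mem_nhds ht.1 ht.2)).hasDerivAt

theorem IsSolutionOn.curve_deriv_continuousAt (i : Fin n) {t : ℝ} (ht : t ∈ Ioo 0 T) :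
    ContinuousAt (deriv (s i)) t :=
  (((S.curve_contDiffOn i).mono Ioo_subset_Ico_self).continuousOn_deriv_of_isOpen isOpen_Ioo
    le_rfl).continuousAt (Ioo_mem_nhds ht.1 ht.2)

theorem IsSolutionOn.curve_tendsto_zero (i : Fin n) (hT : 0 < T) :
    Tendsto (s i) (𝓝[>] 0) (𝓝 0) := by
  have h := (S.curve_contDiffOn i).continuousOn 0 ⟨le_rfl, hT⟩
  rw [ContinuousWithinAt, S.curve_zero i, nhdsWithin_Ico_eq_nhdsGE hT] at h
  exact h.mono_left (nhdsWithin_mono _ Ioi_subset_Ici_self)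

theorem IsSolutionOn.exists_initial_speed (i : Fin n) (hT : 0 < T) :
    ∃ σ, Tendsto (fun t => s i t / t) (𝓝[>] 0) (𝓝 σ) ∧
      Tendsto (deriv (s i)) (𝓝[>] 0) (𝓝 σ) := by
  have h0 : (0 : ℝ) ∈ Ico 0 T := ⟨le_rfl, hT⟩
  refine ⟨derivWithin (s i) (Ico 0 T) 0, ?_, ?_⟩
  · have h := (((S.curve_contDiffOn i).differentiableOn one_ne_zero) 0 h0).hasDerivWithinAt
    rw [hasDerivWithinAt_iff_tendsto_slope] at h
    have h' := h.mono_left (nhdsWithin_mono (0 : ℝ) (s := Ioo 0 T)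
      fun t ht => ⟨Ioo_subset_Ico_self ht, ht.1.ne'⟩)
    rw [nhdsWithin_Ioo_eq_nhdsGT hT] at h'
    refine h'.congr fun t => ?_
    simp [slope_def_field, S.curve_zero i]
  · have h := (S.curve_contDiffOn i).continuousOn_derivWithin (uniqueDiffOn_Ico 0 T) le_rfl 0 h0
    have h' := h.tendsto.mono_left (nhdsWithin_mono (0 : ℝ) (Ioo_subset_Ico_self (a := 0) (b := T)))
    rw [nhdsWithin_Ioo_eq_nhdsGT hT] at h'
    refine h'.congr' ?_
    filter_upwards [Ioo_mem_nhdsGT hT] with t ht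
    exact derivWithin_of_mem_nhds (Ico_mem_nhds ht.1 ht.2)

/-- The curves are strictly ordered at `t₀ > 0`, so near the `i`-th one the others stay away. Curves
are numbered from `0`, hence sector `i` lies on its left and sector `i + 1` on its right. -/
theorem IsSolutionOn.eventually_mem_sector (i : Fin n) {t₀ : ℝ} (ht : t₀ ∈ Ioo 0 T)
    (hx : s i t₀ ∈ Ioo (-δ) δ) :
    (∀ᶠ z : ℝ × ℝ in 𝓝 (t₀, 0), z.2 < 0 → (z.1, z.2 + s i z.1) ∈ sector T δ s i) ∧
    (∀ᶠ z : ℝ × ℝ in 𝓝 (t₀, 0), 0 < z.2 → (z.1, z.2 + s i z.1) ∈ sector T δ s (i + 1)) := by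
  have hc : ∀ j, Tendsto (fun z : ℝ × ℝ => s j z.1) (𝓝 (t₀, 0)) (𝓝 (s j t₀)) := fun j =>
    (S.curve_continuousAt j ht).tendsto.comp continuous_fst.continuousAt
  have hψ : Tendsto (fun z : ℝ × ℝ => z.2 + s i z.1) (𝓝 (t₀, 0)) (𝓝 (s i t₀)) := by
    simpa using (continuous_snd.tendsto ((t₀, 0) : ℝ × ℝ)).add (hc i)
  have hmono := S.curve_strictMono t₀ ht
  have h1 : ∀ᶠ z : ℝ × ℝ in 𝓝 (t₀, 0), z.1 ∈ Ioo 0 T :=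
    continuous_fst.continuousAt.eventually (Ioo_mem_nhds ht.1 ht.2)
  have h2 : ∀ᶠ z : ℝ × ℝ in 𝓝 (t₀, 0), z.2 + s i z.1 ∈ Ioo (-δ) δ :=
    hψ.eventually (Ioo_mem_nhds hx.1 hx.2)
  have h3 : ∀ᶠ z : ℝ × ℝ in 𝓝 (t₀, 0), ∀ j, j < i → s j z.1 < z.2 + s i z.1 :=
    eventually_all.2 fun j => by
      by_cases h : j < i
      · filter_upwards [(hc j).eventually_lt hψ (hmono h)] with z hz _ using hz
      · exact Eventually.of_forall fun z h' => absurd h' h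
  have h4 : ∀ᶠ z : ℝ × ℝ in 𝓝 (t₀, 0), ∀ j, i < j → z.2 + s i z.1 < s j z.1 :=
    eventually_all.2 fun j => by
      by_cases h : i < j
      · filter_upwards [hψ.eventually_lt (hc j) (hmono h)] with z hz _ using hz
      · exact Eventually.of_forall fun z h' => absurd h' h
  constructor
  · filter_upwards [h1, h2, h3, h4] with z h1 h2 h3 h4 hz
    refine ⟨h1, h2, fun j => ⟨fun h => h3 j h, fun h => ?_⟩⟩
    rcases (show i ≤ j from h).eq_or_lt with rfl | h
    · simpa using hz
    · exact h4 j h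
  · filter_upwards [h1, h2, h3, h4] with z h1 h2 h3 h4 hz
    refine ⟨h1, h2, fun j => ⟨fun h => ?_, fun h => h4 j h⟩⟩
    rcases (show j ≤ i from Nat.lt_succ_iff.1 h).eq_or_lt with rfl | h
    · simpa using hz
    · exact h3 j h

theorem IsSolutionOn.tendsto_straighten (i : Fin n) {t₀ : ℝ} (ht : t₀ ∈ Ioo 0 T) :
    Tendsto (fun z : ℝ × ℝ => (z.1, z.2 + s i z.1)) (𝓝 (t₀, 0)) (𝓝 (t₀, s i t₀)) := by
  simpa using (hasFDerivAt_straighten (z := (t₀, 0))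
    (S.curve_hasDerivAt i ht)).continuousAt.tendsto

/-- A sector need not be convex. In the coordinate `y = x - s i t` the curve becomes `y = 0` and
each side a half-plane, where the extension lemma applies; `φ = ∓y` treats both sides at once. -/
theorem IsSolutionOn.hasFDerivWithinAt_side (hG : IsPieceDeriv V T δ s G) (i : Fin n) {t₀ : ℝ}
    (ht : t₀ ∈ Ioo 0 T) (hx : s i t₀ ∈ Ioo (-δ) δ) {k : ℕ} (hk : k ≤ n) (φ : ℝ × ℝ →L[ℝ] ℝ)
    {w : ℝ × ℝ} (hw : 0 < φ w) (hφ : φ (t₀, 0) = 0)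
    (hmem : ∀ᶠ z : ℝ × ℝ in 𝓝 (t₀, 0), 0 < φ z → (z.1, z.2 + s i z.1) ∈ sector T δ s k) :
    (t₀, s i t₀) ∈ closure (sector T δ s k) ∧
    HasFDerivWithinAt (fun z : ℝ × ℝ => V (z.1, z.2 + s i z.1))
      ((G k (t₀, s i t₀)).comp (shear (deriv (s i) t₀))) {z | 0 ≤ φ z} (t₀, 0) := by
  have hne := nhdsWithin_halfSpace_neBot φ hw hφ.ge
  have hψ := S.tendsto_straighten i ht
  have hmem' := eventually_nhdsWithin_iff.2 hmem
  have hcl : (t₀, s i t₀) ∈ closure (sector T δ s k) :=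
    mem_closure_of_tendsto (b := 𝓝[{z | 0 < φ z}] (t₀, 0)) (hψ.mono_left nhdsWithin_le_nhds) hmem'
  have hST : spaceTime T δ ∈ 𝓝 (t₀, s i t₀) := spaceTime_mem_nhds ht hx
  have hin : ∀ᶠ z : ℝ × ℝ in 𝓝 (t₀, 0), z.1 ∈ Ioo 0 T :=
    continuous_fst.continuousAt.eventually (Ioo_mem_nhds ht.1 ht.2)
  have hin2 : ∀ᶠ z : ℝ × ℝ in 𝓝 (t₀, 0), z.2 + s i z.1 ∈ Ioo (-δ) δ :=
    (continuous_snd.tendsto _).comp hψ |>.eventually (Ioo_mem_nhds hx.1 hx.2)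
  refine ⟨hcl, hasFDerivWithinAt_halfSpace φ hw
    (f' := fun z => (G k (z.1, z.2 + s i z.1)).comp (shear (deriv (s i) z.1))) ?_ ?_ ?_⟩
  · filter_upwards [nhdsWithin_le_nhds hin, nhdsWithin_le_nhds hin2] with z hz hz2
    refine ContinuousAt.continuousWithinAt ?_
    exact ContinuousAt.comp (g := V) (S.continuousOn.continuousAt (spaceTime_mem_nhds hz hz2))
      (hasFDerivAt_straighten (S.curve_hasDerivAt i hz)).continuousAt
  · filter_upwards [nhdsWithin_le_nhds hin, hmem'] with z hz hz2
    exact HasFDerivAt.comp (g := V) z (hG.hasFDerivAt k hk _ hz2)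
      (hasFDerivAt_straighten (S.curve_hasDerivAt i hz))
  · refine ((continuous_fst.clm_comp continuous_snd).tendsto
      (G k (t₀, s i t₀), shear (deriv (s i) t₀))).comp (Tendsto.prodMk_nhds ?_ ?_)
    · refine (hG.continuousOn k hk _ ⟨hcl, mem_of_mem_nhds hST⟩).tendsto.comp
        (tendsto_nhdsWithin_iff.2 ⟨hψ.mono_left nhdsWithin_le_nhds, ?_⟩)
      filter_upwards [hmem'] with z hz using ⟨subset_closure hz, sector_subset_spaceTime k hz⟩
    · exact (continuous_shear.tendsto _).comp (((S.curve_deriv_continuousAt i ht).tendsto.comp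
        (continuous_fst.tendsto ((t₀, 0) : ℝ × ℝ))).mono_left nhdsWithin_le_nhds)

theorem IsSolutionOn.hasFDerivWithinAt_left (hG : IsPieceDeriv V T δ s G) (i : Fin n) {t₀ : ℝ}
    (ht : t₀ ∈ Ioo 0 T) (hx : s i t₀ ∈ Ioo (-δ) δ) :
    (t₀, s i t₀) ∈ closure (sector T δ s i) ∧
    HasFDerivWithinAt (fun z : ℝ × ℝ => V (z.1, z.2 + s i z.1))
      ((G i (t₀, s i t₀)).comp (shear (deriv (s i) t₀))) {z | z.2 ≤ 0} (t₀, 0) := by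
  simpa using S.hasFDerivWithinAt_side hG i ht hx i.2.le (-ContinuousLinearMap.snd ℝ ℝ ℝ)
    (w := (0, -1)) (by simp) (by simp) (by simpa using (S.eventually_mem_sector i ht hx).1)

theorem IsSolutionOn.hasFDerivWithinAt_right (hG : IsPieceDeriv V T δ s G) (i : Fin n) {t₀ : ℝ}
    (ht : t₀ ∈ Ioo 0 T) (hx : s i t₀ ∈ Ioo (-δ) δ) :
    (t₀, s i t₀) ∈ closure (sector T δ s (i + 1)) ∧
    HasFDerivWithinAt (fun z : ℝ × ℝ => V (z.1, z.2 + s i z.1))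
      ((G (i + 1) (t₀, s i t₀)).comp (shear (deriv (s i) t₀))) {z | 0 ≤ z.2} (t₀, 0) := by
  simpa using S.hasFDerivWithinAt_side hG i ht hx i.2 (ContinuousLinearMap.snd ℝ ℝ ℝ)
    (w := (0, 1)) (by simp) (by simp) (by simpa using (S.eventually_mem_sector i ht hx).2)

/-- The derivatives on the two sides of a curve agree in the tangential direction. -/
theorem IsSolutionOn.tangential_deriv_eq (hG : IsPieceDeriv V T δ s G) (i : Fin n) {t₀ : ℝ}
    (ht : t₀ ∈ Ioo 0 T) (hx : s i t₀ ∈ Ioo (-δ) δ) :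
    G i (t₀, s i t₀) (1, deriv (s i) t₀) = G (i + 1) (t₀, s i t₀) (1, deriv (s i) t₀) := by
  have hp : HasDerivAt (fun τ : ℝ => ((τ, 0) : ℝ × ℝ)) (1, 0) t₀ :=
    (hasDerivAt_id t₀).prodMk (hasDerivAt_const t₀ 0)
  -- Both one-sided differentials compute the derivative of the same function `τ ↦ V (τ, s i τ)`.
  have h1 := (S.hasFDerivWithinAt_left hG i ht hx).2.comp_hasDerivWithinAt t₀
    (hp.hasDerivWithinAt (s := univ)) (fun τ _ => le_refl (0 : ℝ))
  have h2 := (S.hasFDerivWithinAt_right hG i ht hx).2.comp_hasDerivWithinAt t₀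
    (hp.hasDerivWithinAt (s := univ)) (fun τ _ => le_refl (0 : ℝ))
  rw [hasDerivWithinAt_univ] at h1 h2
  simpa [shear_apply] using h1.unique h2

/-- A component whose slope does not jump across a curve has a time derivative on the curve. -/
theorem IsSolutionOn.hasDerivAt_time_of_slope_eq (hG : IsPieceDeriv V T δ s G) (i : Fin n)
    {t₀ : ℝ} (ht : t₀ ∈ Ioo 0 T) (hx : s i t₀ ∈ Ioo (-δ) δ) (j : Fin 4)
    (hj : G i (t₀, s i t₀) (0, 1) j = G (i + 1) (t₀, s i t₀) (0, 1) j) :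
    HasDerivAt (fun τ => V (τ, s i t₀) j) (G i (t₀, s i t₀) (1, 0) j) t₀ := by
  set σ := deriv (s i) t₀ with hσ
  set z₀ : ℝ × ℝ := (t₀, s i t₀) with hz₀
  have htan : G i z₀ (1, σ) j = G (i + 1) z₀ (1, σ) j :=
    congrFun (S.tangential_deriv_eq hG i ht hx) j
  -- The directions `(1, σ)` and `(0, 1)` span the plane, so agreement in both makes the two
  -- one-sided differentials of the component equal.
  have hcomp : ∀ k, (ContinuousLinearMap.proj (R := ℝ) (φ := fun _ : Fin 4 => ℝ) j).comp
      ((G k z₀).comp (shear σ)) = G k z₀ (1, σ) j • ContinuousLinearMap.fst ℝ ℝ ℝ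
        + G k z₀ (0, 1) j • ContinuousLinearMap.snd ℝ ℝ ℝ := by
    intro k
    ext
    · simp [shear_apply]
    · simp [shear_apply]
  have h1 := (hasFDerivWithinAt_pi'.1 (S.hasFDerivWithinAt_left hG i ht hx).2) j
  have h2 := (hasFDerivWithinAt_pi'.1 (S.hasFDerivWithinAt_right hG i ht hx).2) j
  rw [hcomp] at h1 h2
  rw [htan, hj] at h1
  have h3 := h1.union h2
  rw [show {z : ℝ × ℝ | z.2 ≤ 0} ∪ {z | 0 ≤ z.2} = univ from
    eq_univ_of_forall fun z => le_total z.2 0, hasFDerivWithinAt_univ, ← htan, ← hj, ← hcomp] at h3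
  -- This path is the line `x = s i t₀` in straightened coordinates.
  have hp : HasDerivAt (fun τ : ℝ => ((τ, s i t₀ - s i τ) : ℝ × ℝ)) (1, -σ) t₀ :=
    (hasDerivAt_id t₀).prodMk ((S.curve_hasDerivAt i ht).const_sub _)
  have h4 := h3.comp_hasDerivAt_of_eq t₀ hp (by simp)
  simpa [Function.comp_def, shear_apply] using h4

end Curve

end Solution

theorem tendsto_clm_apply {X E F : Type*} [NormedAddCommGroup E] [NormedSpace ℝ E]
    [NormedAddCommGroup F] [NormedSpace ℝ F] {l : Filter X} {f : X → E →L[ℝ] F} {g : X → E}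
    {f₀ : E →L[ℝ] F} {g₀ : E} (hf : Tendsto f l (𝓝 f₀)) (hg : Tendsto g l (𝓝 g₀)) :
    Tendsto (fun x => f x (g x)) l (𝓝 (f₀ g₀)) :=
  ((continuous_fst.clm_apply continuous_snd).tendsto (f₀, g₀)).comp (hf.prodMk_nhds hg)

section Origin

variable {Γ : ℝ} {src : Fin 4 → ℝ} {V₀ : ℝ → Fin 4 → ℝ} {V : ℝ × ℝ → Fin 4 → ℝ} {T δ : ℝ}
  {n : ℕ} {s : Fin n → ℝ → ℝ} {G : ℕ → ℝ × ℝ → (ℝ × ℝ →L[ℝ] (Fin 4 → ℝ))}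

/-! ### The balance law and the jump relations on the closed sectors -/

section Jump

variable (S : IsSolutionOn Γ src V₀ V T δ s)
include S

theorem IsSolutionOn.linBalance (hG : IsPieceDeriv V T δ s G) (hΓ : 1 < Γ) {k : ℕ} (hk : k ≤ n)
    {z : ℝ × ℝ} (hz : z ∈ closure (sector T δ s k) ∩ spaceTime T δ) :
    LinBalance Γ src (V z) (G k z (1, 0)) (G k z (0, 1)) := by
  intro j
  have hne := mem_closure_iff_nhdsWithin_neBot.1 hz.1
  have hsub : sector T δ s k ⊆ closure (sector T δ s k) ∩ spaceTime T δ :=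
    subset_inter subset_closure (sector_subset_spaceTime k)
  have hV : Tendsto V (𝓝[sector T δ s k] z) (𝓝 (V z)) :=
    (S.continuousOn z hz.2).mono_left (nhdsWithin_mono _ (sector_subset_spaceTime k))
  have hGz : Tendsto (G k) (𝓝[sector T δ s k] z) (𝓝 (G k z)) :=
    (hG.continuousOn k hk z hz).mono_left (nhdsWithin_mono _ hsub)
  have hGe : ∀ e : ℝ × ℝ, Tendsto (fun w => G k w e) (𝓝[sector T δ s k] z) (𝓝 (G k z e)) :=
    fun e => ((ContinuousLinearMap.apply ℝ (Fin 4 → ℝ) e).continuous.tendsto _).comp hGz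
  have hq := S.admissible z hz.2
  refine tendsto_nhds_unique_of_eventuallyEq ((tendsto_dCons hΓ hV (hGe (1, 0)) hq j).add
    (tendsto_dFlux hΓ hV (hGe (0, 1)) hq j)) tendsto_const_nhds ?_
  filter_upwards [self_mem_nhdsWithin] with w hw
  have hqw := S.admissible w (sector_subset_spaceTime k hw)
  have hd := hG.hasFDerivAt k hk w hw
  have ht : HasDerivAt (fun t => V (t, w.2)) (G k w (1, 0)) w.1 :=
    hd.comp_hasDerivAt_of_eq w.1 ((hasDerivAt_id w.1).prodMk (hasDerivAt_const w.1 w.2)) rfl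
  have hx : HasDerivAt (fun x => V (w.1, x)) (G k w (0, 1)) w.2 :=
    hd.comp_hasDerivAt_of_eq w.2 ((hasDerivAt_const w.2 w.1).prodMk (hasDerivAt_id w.2)) rfl
  rw [← S.balance k hk w hw j, (hasDerivAt_consVec hΓ ht hqw j).deriv,
    (hasDerivAt_fluxX hΓ hx hqw j).deriv]

theorem IsSolutionOn.isJump_of_tangential (hG : IsPieceDeriv V T δ s G) (hΓ : 1 < Γ) (i : Fin n)
    {z : ℝ × ℝ} (hz : z ∈ closure (sector T δ s i) ∩ spaceTime T δ)
    (hz' : z ∈ closure (sector T δ s (i + 1)) ∩ spaceTime T δ) {σ : ℝ}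
    (h : G i z (1, σ) = G (i + 1) z (1, σ)) :
    IsJump Γ (V z) σ (G (i + 1) z (0, 1) - G i z (0, 1)) := by
  have h1 := (S.linBalance hG hΓ i.2 hz').sub (S.linBalance hG hΓ i.2.le hz)
  have e : ∀ k, G k z (1, σ) = G k z (1, 0) + σ • G k z (0, 1) := fun k => by
    rw [← map_smul, ← map_add]; simp
  rw [e, e] at h
  have h2 : G (i + 1) z (1, 0) - G i z (1, 0)
      = -σ • (G (i + 1) z (0, 1) - G i z (0, 1)) := by
    rw [neg_smul, smul_sub, neg_sub, sub_eq_sub_iff_add_eq_add, ← h]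
    abel
  rwa [h2] at h1

theorem IsSolutionOn.isJump_curve (hG : IsPieceDeriv V T δ s G) (hΓ : 1 < Γ) (i : Fin n)
    {t : ℝ} (ht : t ∈ Ioo 0 T) (hx : s i t ∈ Ioo (-δ) δ) :
    IsJump Γ (V (t, s i t)) (deriv (s i) t)
      (G (i + 1) (t, s i t) (0, 1) - G i (t, s i t) (0, 1)) :=
  have hST : (t, s i t) ∈ spaceTime T δ := ⟨Ioo_subset_Ico_self ht, hx⟩
  S.isJump_of_tangential hG hΓ i ⟨(S.hasFDerivWithinAt_left hG i ht hx).1, hST⟩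
    ⟨(S.hasFDerivWithinAt_right hG i ht hx).1, hST⟩ (S.tangential_deriv_eq hG i ht hx)

theorem IsSolutionOn.eventually_curve (hT : 0 < T) (hδ : 0 < δ) (i : Fin n) :
    ∀ᶠ t in 𝓝[>] (0 : ℝ), t ∈ Ioo 0 T ∧ s i t ∈ Ioo (-δ) δ := by
  filter_upwards [Ioo_mem_nhdsGT hT, (S.curve_tendsto_zero i hT).eventually
    (Ioo_mem_nhds (neg_lt_zero.2 hδ) hδ)] with t h1 h2 using ⟨h1, h2⟩

theorem IsSolutionOn.tendsto_curve (hT : 0 < T) (i : Fin n) :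
    Tendsto (fun t => (t, s i t)) (𝓝[>] 0) (𝓝 ((0 : ℝ), (0 : ℝ))) :=
  (tendsto_id.mono_left nhdsWithin_le_nhds).prodMk_nhds (S.curve_tendsto_zero i hT)

/-- Each sector is bounded by a curve ending at the origin: curve `k` if `k < n`, the last curve if
`k = n > 0`. Without curves the only sector is the whole strip. -/
theorem IsSolutionOn.zero_mem_closure_sector (hG : IsPieceDeriv V T δ s G) (hT : 0 < T)
    (hδ : 0 < δ) {k : ℕ} (hk : k ≤ n) : ((0 : ℝ), (0 : ℝ)) ∈ closure (sector T δ s k) := by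
  rcases hk.lt_or_eq with h | rfl
  · refine isClosed_closure.mem_of_tendsto (S.tendsto_curve hT ⟨k, h⟩) ?_
    filter_upwards [S.eventually_curve hT hδ ⟨k, h⟩] with t ht
    exact (S.hasFDerivWithinAt_left hG ⟨k, h⟩ ht.1 ht.2).1
  · rcases k with _ | k
    · have h : Tendsto (fun t : ℝ => (t, (0 : ℝ))) (𝓝[>] 0) (𝓝 (0, 0)) :=
        (tendsto_id.mono_left nhdsWithin_le_nhds).prodMk_nhds tendsto_const_nhds
      refine mem_closure_of_tendsto h ?_
      filter_upwards [Ioo_mem_nhdsGT hT] with t ht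
      exact ⟨ht, ⟨neg_lt_zero.2 hδ, hδ⟩, fun i => i.elim0⟩
    · refine isClosed_closure.mem_of_tendsto (S.tendsto_curve hT (Fin.last k)) ?_
      filter_upwards [S.eventually_curve hT hδ (Fin.last k)] with t ht
      exact (S.hasFDerivWithinAt_right hG (Fin.last k) ht.1 ht.2).1

theorem IsSolutionOn.isJump_origin (hG : IsPieceDeriv V T δ s G) (hΓ : 1 < Γ) (hT : 0 < T)
    (hδ : 0 < δ) (i : Fin n) {σ : ℝ} (hσ : Tendsto (deriv (s i)) (𝓝[>] 0) (𝓝 σ)) :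
    IsJump Γ (V (0, 0)) σ (G (i + 1) (0, 0) (0, 1) - G i (0, 0) (0, 1)) := by
  have hST : ((0 : ℝ), (0 : ℝ)) ∈ spaceTime T δ := ⟨⟨le_rfl, hT⟩, neg_lt_zero.2 hδ, hδ⟩
  have hev := S.eventually_curve hT hδ i
  have hl := S.zero_mem_closure_sector hG hT hδ i.2.le
  have hr := S.zero_mem_closure_sector hG hT hδ i.2
  refine S.isJump_of_tangential hG hΓ i ⟨hl, hST⟩ ⟨hr, hST⟩ ?_
  have hlim : ∀ k ≤ n, (∀ t ∈ Ioo 0 T, s i t ∈ Ioo (-δ) δ →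
      (t, s i t) ∈ closure (sector T δ s k)) → Tendsto
        (fun t => G k (t, s i t) (1, deriv (s i) t)) (𝓝[>] 0) (𝓝 (G k (0, 0) (1, σ))) := by
    intro k hk h
    have h1 : Tendsto (fun t => G k (t, s i t)) (𝓝[>] 0) (𝓝 (G k (0, 0))) := by
      refine (hG.continuousOn k hk _ ⟨S.zero_mem_closure_sector hG hT hδ hk, hST⟩).tendsto.comp
        (tendsto_nhdsWithin_iff.2 ⟨S.tendsto_curve hT i, ?_⟩)
      filter_upwards [hev] with t ht
      exact ⟨h t ht.1 ht.2, Ioo_subset_Ico_self ht.1, ht.2⟩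
    exact tendsto_clm_apply h1 (tendsto_const_nhds.prodMk_nhds hσ)
  refine tendsto_nhds_unique_of_eventuallyEq
    (hlim i i.2.le fun t h1 h2 => (S.hasFDerivWithinAt_left hG i h1 h2).1)
    (hlim (i + 1) i.2 fun t h1 h2 => (S.hasFDerivWithinAt_right hG i h1 h2).1) ?_
  filter_upwards [hev] with t ht using S.tangential_deriv_eq hG i ht.1 ht.2

end Jump

/-! ### The initial slopes -/

section Initial

variable (S : IsSolutionOn Γ src V₀ V T δ s)
include S

/-- Used at `x₀ ≠ 0`, where a single outer sector fills the upper half of a neighbourhood: `V` is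
then differentiable up to `t = 0` and can be restricted to the initial line. -/
theorem IsSolutionOn.hasDerivAt_initial (hG : IsPieceDeriv V T δ s G) (hT : 0 < T) {k : ℕ}
    (hk : k ≤ n) {x₀ : ℝ} (hx : x₀ ∈ Ioo (-δ) δ)
    (h : ∀ᶠ z in 𝓝[{z : ℝ × ℝ | 0 < z.1}] (0, x₀), z ∈ sector T δ s k) :
    (0, x₀) ∈ closure (sector T δ s k) ∧ HasDerivAt V₀ (G k (0, x₀) (0, 1)) x₀ := by
  have hne : (𝓝[{z : ℝ × ℝ | 0 < z.1}] (0, x₀)).NeBot :=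
    nhdsWithin_halfSpace_neBot (ContinuousLinearMap.fst ℝ ℝ ℝ) (w := (1, 0)) (by simp) (by simp)
  have hcl : ((0 : ℝ), x₀) ∈ closure (sector T δ s k) :=
    mem_closure_of_tendsto (tendsto_id.mono_left nhdsWithin_le_nhds) h
  have hST : ((0 : ℝ), x₀) ∈ spaceTime T δ := ⟨⟨le_rfl, hT⟩, hx⟩
  refine ⟨hcl, ?_⟩
  have h1 : HasFDerivWithinAt V (G k (0, x₀)) {z | 0 ≤ z.1} (0, x₀) := by
    refine hasFDerivWithinAt_halfSpace (ContinuousLinearMap.fst ℝ ℝ ℝ) (w := (1, 0))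
      (f' := G k) (by simp) ?_ (h.mono (hG.hasFDerivAt k hk)) ?_
    · have hU : IsOpen {z : ℝ × ℝ | z.1 < T ∧ z.2 ∈ Ioo (-δ) δ} :=
        (isOpen_Iio.preimage continuous_fst).inter (isOpen_Ioo.preimage continuous_snd)
      filter_upwards [nhdsWithin_le_nhds (hU.mem_nhds ⟨hT, hx⟩), self_mem_nhdsWithin]
        with z hz hz0
      refine (S.continuousOn z ⟨⟨hz0, hz.1⟩, hz.2⟩).mono_of_mem_nhdsWithin ?_
      filter_upwards [nhdsWithin_le_nhds (hU.mem_nhds hz), self_mem_nhdsWithin] with w hw hw0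
      exact ⟨⟨hw0, hw.1⟩, hw.2⟩
    · refine (hG.continuousOn k hk _ ⟨hcl, hST⟩).tendsto.mono_left ?_
      refine nhdsWithin_le_iff.2 ?_
      filter_upwards [h] with z hz using ⟨subset_closure hz, sector_subset_spaceTime k hz⟩
  have hp : HasDerivAt (fun x : ℝ => ((0 : ℝ), x)) (0, 1) x₀ :=
    (hasDerivAt_const x₀ 0).prodMk (hasDerivAt_id x₀)
  have h2 := h1.comp_hasDerivWithinAt x₀ (hp.hasDerivWithinAt (s := univ))
    (fun x _ => le_refl (0 : ℝ))
  rw [hasDerivWithinAt_univ] at h2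
  refine h2.congr_of_eventuallyEq ?_
  filter_upwards [Ioo_mem_nhds hx.1 hx.2] with x hx using (S.initial x hx).symm

theorem IsSolutionOn.eventually_mem_outer_sector (hT : 0 < T) {x₀ : ℝ} (hx : x₀ ∈ Ioo (-δ) δ) :
    (x₀ < 0 → ∀ᶠ z in 𝓝[{z : ℝ × ℝ | 0 < z.1}] (0, x₀), z ∈ sector T δ s 0) ∧
    (0 < x₀ → ∀ᶠ z in 𝓝[{z : ℝ × ℝ | 0 < z.1}] (0, x₀), z ∈ sector T δ s n) := by
  have hfst : Tendsto Prod.fst (𝓝[{z : ℝ × ℝ | 0 < z.1}] (0, x₀)) (𝓝[>] 0) :=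
    tendsto_nhdsWithin_iff.2 ⟨(continuous_fst.tendsto _).mono_left nhdsWithin_le_nhds,
      self_mem_nhdsWithin⟩
  have hsnd : Tendsto Prod.snd (𝓝[{z : ℝ × ℝ | 0 < z.1}] (0, x₀)) (𝓝 x₀) :=
    (continuous_snd.tendsto _).mono_left nhdsWithin_le_nhds
  have h1 := hfst.eventually (Ioo_mem_nhdsGT hT)
  have h2 := hsnd.eventually (Ioo_mem_nhds hx.1 hx.2)
  have hs : ∀ j, Tendsto (fun z : ℝ × ℝ => s j z.1) (𝓝[{z : ℝ × ℝ | 0 < z.1}] (0, x₀)) (𝓝 0) :=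
    fun j => (S.curve_tendsto_zero j hT).comp hfst
  constructor
  · intro h0
    filter_upwards [h1, h2, eventually_all.2 fun j => hsnd.eventually_lt (hs j) h0]
      with z h1 h2 h3
    exact ⟨h1, h2, fun j => ⟨fun h => absurd h (Nat.not_lt_zero _), fun _ => h3 j⟩⟩
  · intro h0
    filter_upwards [h1, h2, eventually_all.2 fun j => (hs j).eventually_lt hsnd h0]
      with z h1 h2 h3
    exact ⟨h1, h2, fun j => ⟨fun _ => h3 j, fun h => absurd j.2 h.not_gt⟩⟩

theorem IsSolutionOn.tendsto_initial_slope (hG : IsPieceDeriv V T δ s G) (hT : 0 < T)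
    (hδ : 0 < δ) {k : ℕ} (hk : k ≤ n) {l : Filter ℝ} (hl : l ≤ 𝓝 0)
    (h : ∀ᶠ x in l, (0, x) ∈ closure (sector T δ s k)) :
    Tendsto (fun x => G k (0, x) (0, 1)) l (𝓝 (G k (0, 0) (0, 1))) := by
  have hST : ((0 : ℝ), (0 : ℝ)) ∈ spaceTime T δ := ⟨⟨le_rfl, hT⟩, neg_lt_zero.2 hδ, hδ⟩
  have h1 : Tendsto (fun x => G k (0, x)) l (𝓝 (G k (0, 0))) := by
    refine (hG.continuousOn k hk _ ⟨S.zero_mem_closure_sector hG hT hδ hk, hST⟩).tendsto.comp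
      (tendsto_nhdsWithin_iff.2 ⟨tendsto_const_nhds.prodMk_nhds hl, ?_⟩)
    filter_upwards [h, hl (Ioo_mem_nhds (neg_lt_zero.2 hδ) hδ)] with x hx hx'
    exact ⟨hx, ⟨le_rfl, hT⟩, hx'⟩
  exact tendsto_clm_apply h1 tendsto_const_nhds

/-- Several sectors may meet at the origin, so the slope is reached as the limit of the derivative
of `V₀` at `x < 0`, which must equal the one-sided derivative at `0`. -/
theorem IsSolutionOn.slope_left (hG : IsPieceDeriv V T δ s G) (hT : 0 < T) (hδ : 0 < δ)
    {qL' : Fin 4 → ℝ} (hL : HasDerivWithinAt V₀ qL' (Iic 0) 0) : G 0 (0, 0) (0, 1) = qL' := by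
  have hx : ∀ x ∈ Ioo (-δ) 0, (0, x) ∈ closure (sector T δ s 0) ∧
      HasDerivAt V₀ (G 0 (0, x) (0, 1)) x := fun x hx =>
    have hx' : x ∈ Ioo (-δ) δ := ⟨hx.1, hx.2.trans hδ⟩
    S.hasDerivAt_initial hG hT n.zero_le hx' ((S.eventually_mem_outer_sector hT hx').1 hx.2)
  have hmem : Ioo (-δ) 0 ∈ 𝓝[<] (0 : ℝ) := Ioo_mem_nhdsLT (neg_lt_zero.2 hδ)
  have h := hasDerivWithinAt_Iic_of_tendsto_deriv (e := G 0 (0, 0) (0, 1))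
    (fun x h => (hx x h).2.differentiableAt.differentiableWithinAt)
    (hL.continuousWithinAt.mono (Ioo_subset_Iio_self.trans Iio_subset_Iic_self)) hmem
    ((S.tendsto_initial_slope hG hT hδ n.zero_le nhdsWithin_le_nhds
      (by filter_upwards [hmem] with x h using (hx x h).1)).congr'
      (by filter_upwards [hmem] with x h using (hx x h).2.deriv.symm))
  exact (uniqueDiffWithinAt_Iic (0 : ℝ)).eq_deriv _ h hL

theorem IsSolutionOn.slope_right (hG : IsPieceDeriv V T δ s G) (hT : 0 < T) (hδ : 0 < δ)
    {qR' : Fin 4 → ℝ} (hR : HasDerivWithinAt V₀ qR' (Ici 0) 0) : G n (0, 0) (0, 1) = qR' := by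
  have hx : ∀ x ∈ Ioo 0 δ, (0, x) ∈ closure (sector T δ s n) ∧
      HasDerivAt V₀ (G n (0, x) (0, 1)) x := fun x hx =>
    have hx' : x ∈ Ioo (-δ) δ := ⟨(neg_lt_zero.2 hδ).trans hx.1, hx.2⟩
    S.hasDerivAt_initial hG hT le_rfl hx' ((S.eventually_mem_outer_sector hT hx').2 hx.1)
  have hmem : Ioo 0 δ ∈ 𝓝[>] (0 : ℝ) := Ioo_mem_nhdsGT hδ
  have h := hasDerivWithinAt_Ici_of_tendsto_deriv (e := G n (0, 0) (0, 1))
    (fun x h => (hx x h).2.differentiableAt.differentiableWithinAt)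
    (hR.continuousWithinAt.mono (Ioo_subset_Ioi_self.trans Ioi_subset_Ici_self)) hmem
    ((S.tendsto_initial_slope hG hT hδ le_rfl nhdsWithin_le_nhds
      (by filter_upwards [hmem] with x h using (hx x h).1)).congr'
      (by filter_upwards [hmem] with x h using (hx x h).2.deriv.symm))
  exact (uniqueDiffWithinAt_Ici (0 : ℝ)).eq_deriv _ h hR

end Initial

/-! ### Time derivatives along `x = 0` -/

theorem exists_sector_index {x : Fin n → ℝ} (hx : StrictMono x) :
    ∃ k ≤ n, (∀ i : Fin n, (i : ℕ) < k → x i < 0) ∧ ∀ i : Fin n, k ≤ (i : ℕ) → 0 ≤ x i := by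
  classical
  have hex : ∃ k, ∀ i : Fin n, k ≤ (i : ℕ) → 0 ≤ x i :=
    ⟨n, fun i hi => absurd i.2 hi.not_gt⟩
  -- The least such `k` puts a curve through `0` on the right, so that at a crossing `k` is the
  -- sector on the left of the curve.
  refine ⟨Nat.find hex, Nat.find_min' hex fun i hi => absurd i.2 hi.not_gt, fun i hi => ?_,
    Nat.find_spec hex⟩
  by_contra! h
  exact Nat.find_min hex hi fun j hj => h.trans (hx.monotone hj)

variable {σ : Fin n → ℝ}

/-- The sectors that can meet the line `x = 0` for arbitrarily small times, when `σ i` is the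
initial speed of the `i`-th curve. -/
def IsCentral (σ : Fin n → ℝ) (k : ℕ) : Prop :=
  ∀ i : Fin n, ((i : ℕ) < k → σ i ≤ 0) ∧ (k ≤ (i : ℕ) → 0 ≤ σ i)

theorem IsSolutionOn.hasLimitTimeDeriv (S : IsSolutionOn Γ src V₀ V T δ s)
    (hG : IsPieceDeriv V T δ s G) (hT : 0 < T) (hδ : 0 < δ)
    (hσ : ∀ i, Tendsto (fun t => s i t / t) (𝓝[>] 0) (𝓝 (σ i))) (j : Fin 4) {a : ℝ}
    (ha : ∀ k ≤ n, IsCentral σ k → G k (0, 0) (1, 0) j = a)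
    (hj : ∀ i, ∀ᶠ t in 𝓝[>] (0 : ℝ), s i t = 0 →
      (G (i + 1) (t, 0) (0, 1) - G i (t, 0) (0, 1)) j = 0) :
    HasLimitTimeDeriv V j a := by
  have hδ0 : (0 : ℝ) ∈ Ioo (-δ) δ := ⟨neg_lt_zero.2 hδ, hδ⟩
  -- For small `t` a nonzero initial speed fixes the sign of `s i t`; a zero speed satisfies both
  -- claims.
  have hsign : ∀ᶠ t in 𝓝[>] (0 : ℝ), ∀ i, (s i t ≤ 0 → σ i ≤ 0) ∧ (0 ≤ s i t → 0 ≤ σ i) := by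
    refine eventually_all.2 fun i => ?_
    rcases lt_trichotomy (σ i) 0 with h | h | h
    · filter_upwards [(hσ i).eventually_lt_const h, self_mem_nhdsWithin] with t h1 h2
      have h2 : 0 < t := h2
      refine ⟨fun _ => h.le, fun h3 => ?_⟩
      exact absurd (div_nonneg h3 h2.le) h1.not_ge
    · exact Eventually.of_forall fun t => ⟨fun _ => h.le, fun _ => h.ge⟩
    · filter_upwards [(hσ i).eventually_const_lt h, self_mem_nhdsWithin] with t h1 h2
      have h2 : 0 < t := h2
      refine ⟨fun h3 => ?_, fun _ => h.le⟩
      exact absurd (div_nonpos_of_nonpos_of_nonneg h3 h2.le) h1.not_ge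
  -- The index `k` may vary with `t` without settling; the limit needs only that it ranges over
  -- finitely many central values.
  have key : ∀ᶠ t in 𝓝[>] (0 : ℝ), ∃ k ≤ n, IsCentral σ k ∧ (t, 0) ∈ closure (sector T δ s k) ∧
      HasDerivAt (fun τ => V (τ, 0) j) (G k (t, 0) (1, 0) j) t := by
    filter_upwards [Ioo_mem_nhdsGT hT, hsign, eventually_all.2 hj] with t ht hsign hj
    obtain ⟨k, hk, hneg, hpos⟩ := exists_sector_index (S.curve_strictMono t ht)
    refine ⟨k, hk, fun i => ⟨fun h => (hsign i).1 (hneg i h).le, fun h => (hsign i).2 (hpos i h)⟩,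
      ?_⟩
    by_cases h0 : ∃ i, s i t = 0
    · obtain ⟨i, hi⟩ := h0
      obtain rfl : k = i := by
        refine le_antisymm ?_ ?_
        · by_contra! h
          exact (hneg i h).ne hi
        · by_contra! h
          have := S.curve_strictMono t ht (show (⟨k, h.trans i.2⟩ : Fin n) < i from h)
          exact absurd (hpos ⟨k, h.trans i.2⟩ le_rfl) (by simpa [hi] using this)
      have hx : s i t ∈ Ioo (-δ) δ := hi ▸ hδ0
      have hcl := (S.hasFDerivWithinAt_left hG i ht hx).1
      have hd := S.hasDerivAt_time_of_slope_eq hG i ht hx j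
      rw [hi] at hcl hd
      exact ⟨hcl, hd (sub_eq_zero.1 (hj i hi)).symm⟩
    · push Not at h0
      have hmem : (t, 0) ∈ sector T δ s k :=
        ⟨ht, hδ0, fun i => ⟨hneg i, fun h => (hpos i h).lt_of_ne (h0 i).symm⟩⟩
      refine ⟨subset_closure hmem, ?_⟩
      have hd := (hG.hasFDerivAt k hk _ hmem).comp_hasDerivAt_of_eq t
        ((hasDerivAt_id t).prodMk (hasDerivAt_const t (0 : ℝ))) rfl
      exact hasDerivAt_pi.1 hd j
  refine ⟨?_, ?_⟩
  · filter_upwards [key] with t ⟨k, _, _, _, h⟩ using h.differentiableAt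
  · rw [Metric.tendsto_nhds]
    intro ε hε
    have hlim : ∀ k : Fin (n + 1), ∀ᶠ t in 𝓝[>] (0 : ℝ), (t, 0) ∈ closure (sector T δ s k) →
        dist (G k (t, 0) (1, 0) j) (G k (0, 0) (1, 0) j) < ε := by
      intro k
      have hk : (k : ℕ) ≤ n := Nat.lt_succ_iff.1 k.2
      have hc := hG.continuousOn k hk (0, 0)
        ⟨S.zero_mem_closure_sector hG hT hδ hk, ⟨le_rfl, hT⟩, hδ0⟩
      have hcj : Tendsto (fun z => G k z (1, 0) j)
          (𝓝[closure (sector T δ s k) ∩ spaceTime T δ] (0, 0)) (𝓝 (G k (0, 0) (1, 0) j)) :=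
        tendsto_pi_nhds.1 (tendsto_clm_apply hc.tendsto tendsto_const_nhds) j
      have h1 := eventually_nhdsWithin_iff.1 (Metric.tendsto_nhds.1 hcj ε hε)
      have h2 : Tendsto (fun t : ℝ => (t, (0 : ℝ))) (𝓝[>] 0) (𝓝 (0, 0)) :=
        (tendsto_id.mono_left nhdsWithin_le_nhds).prodMk_nhds tendsto_const_nhds
      filter_upwards [h2.eventually h1, Ioo_mem_nhdsGT hT] with t ht ht' hcl
      exact ht ⟨hcl, Ioo_subset_Ico_self ht', hδ0⟩
    filter_upwards [key, eventually_all.2 hlim] with t ⟨k, hk, hcen, hcl, hd⟩ h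
    rw [hd.deriv, ← ha k hk hcen]
    exact h ⟨k, Nat.lt_succ_iff.2 hk⟩ hcl

end Origin

/-! ### Resolution of the jumps -/

theorem eq_of_no_jumps {f : ℕ → ℝ} {a c : ℕ} (hac : a ≤ c)
    (h : ∀ i, a ≤ i → i < c → f (i + 1) - f i = 0) : f c = f a := by
  induction c, hac using Nat.le_induction with
  | base => rfl
  | succ c hc ih =>
    rw [← ih fun i h1 h2 => h i h1 (h2.trans c.lt_succ_self)]
    exact sub_eq_zero.1 (h c hc c.lt_succ_self)

theorem slopeTangential_sub {Γ : ℝ} {q : Fin 4 → ℝ} (b b' : Fin 4 → ℝ) :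
    slopeTangential Γ q (b - b') = slopeTangential Γ q b - slopeTangential Γ q b' := by
  simp [slopeTangential, dEnthalpy, rho, velX, velY, pres]
  ring

section Fan

variable {Γ : ℝ} {src q : Fin 4 → ℝ} {n : ℕ} {σ : Fin n → ℝ} {b : ℕ → Fin 4 → ℝ} {k : ℕ}

theorem fast_eq_left (hΓ : 1 < Γ) (hΓ' : Γ ≤ 2) (hq : Admissible q) (h₄ : 0 < lam4 Γ q)
    (hb : ∀ i : Fin n, IsJump Γ q (σ i) (b (i + 1) - b i)) (hk : k ≤ n) (hc : IsCentral σ k) :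
    velX (b k) + capPhi Γ q * pres (b k) = velX (b 0) + capPhi Γ q * pres (b 0) := by
  refine eq_of_no_jumps (f := fun k => velX (b k) + capPhi Γ q * pres (b k)) k.zero_le
    fun i _ hi => ?_
  have := (hb ⟨i, hi.trans_le hk⟩).fast_eq_zero hΓ hΓ' hq
    (((hc ⟨i, hi.trans_le hk⟩).1 hi).trans_lt h₄).ne
  simp only [velX, pres, Pi.sub_apply] at this ⊢
  linarith

theorem slow_eq_right (hΓ : 1 < Γ) (hΓ' : Γ ≤ 2) (hq : Admissible q) (h₁ : lam1 Γ q < 0)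
    (hb : ∀ i : Fin n, IsJump Γ q (σ i) (b (i + 1) - b i)) (hk : k ≤ n) (hc : IsCentral σ k) :
    velX (b k) - capPhi Γ q * pres (b k) = velX (b n) - capPhi Γ q * pres (b n) := by
  refine (eq_of_no_jumps (f := fun k => velX (b k) - capPhi Γ q * pres (b k)) hk
    fun i hi hi' => ?_).symm
  have := (hb ⟨i, hi'⟩).slow_eq_zero hΓ hΓ' hq (h₁.trans_le ((hc ⟨i, hi'⟩).2 hi)).ne'
  simp only [velX, pres, Pi.sub_apply] at this ⊢
  linarith

theorem contact_eq_left (hΓ : 1 < Γ) (hq : Admissible q) (hu : 0 < velX q)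
    (hb : ∀ i : Fin n, IsJump Γ q (σ i) (b (i + 1) - b i)) (hk : k ≤ n) (hc : IsCentral σ k) :
    pres (b k) - soundSq Γ q * enthalpy Γ q * rho (b k)
        = pres (b 0) - soundSq Γ q * enthalpy Γ q * rho (b 0) ∧
      slopeTangential Γ q (b k) = slopeTangential Γ q (b 0) := by
  have hne : ∀ i (hi : i < k), σ ⟨i, hi.trans_le hk⟩ ≠ velX q := fun i hi =>
    (((hc ⟨i, hi.trans_le hk⟩).1 hi).trans_lt hu).ne
  constructor
  · refine eq_of_no_jumps (f := fun k => pres (b k) - soundSq Γ q * enthalpy Γ q * rho (b k))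
      k.zero_le fun i _ hi => ?_
    have := (hb ⟨i, hi.trans_le hk⟩).entropy_eq_zero hΓ hq (hne i hi)
    simp only [rho, pres, Pi.sub_apply] at this ⊢
    linarith
  · refine eq_of_no_jumps (f := fun k => slopeTangential Γ q (b k)) k.zero_le fun i _ hi => ?_
    have := (hb ⟨i, hi.trans_le hk⟩).tangential_eq_zero hq (hne i hi)
    rwa [slopeTangential_sub] at this

theorem contact_eq_right (hΓ : 1 < Γ) (hq : Admissible q) (hu : velX q < 0)
    (hb : ∀ i : Fin n, IsJump Γ q (σ i) (b (i + 1) - b i)) (hk : k ≤ n) (hc : IsCentral σ k) :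
    pres (b k) - soundSq Γ q * enthalpy Γ q * rho (b k)
        = pres (b n) - soundSq Γ q * enthalpy Γ q * rho (b n) ∧
      slopeTangential Γ q (b k) = slopeTangential Γ q (b n) := by
  have hne : ∀ i (_ : k ≤ i) (hi' : i < n), σ ⟨i, hi'⟩ ≠ velX q := fun i hi hi' =>
    (hu.trans_le ((hc ⟨i, hi'⟩).2 hi)).ne'
  constructor
  · refine (eq_of_no_jumps (f := fun k => pres (b k) - soundSq Γ q * enthalpy Γ q * rho (b k))
      hk fun i hi hi' => ?_).symm
    have := (hb ⟨i, hi'⟩).entropy_eq_zero hΓ hq (hne i hi hi')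
    simp only [rho, pres, Pi.sub_apply] at this ⊢
    linarith
  · refine (eq_of_no_jumps (f := fun k => slopeTangential Γ q (b k)) hk fun i hi hi' => ?_).symm
    have := (hb ⟨i, hi'⟩).tangential_eq_zero hq (hne i hi hi')
    rwa [slopeTangential_sub] at this

end Fan

/-! ### The time derivatives in a central sector -/

/-- The limiting value of `∂u/∂t`. -/
noncomputable def acousticU (Γ : ℝ) (src q qL' qR' : Fin 4 → ℝ) : ℝ :=
  1 / (lam4 Γ q - lam1 Γ q) *
    (lam4 Γ q * (srcU Γ src q + (coefM Γ q + lam1 Γ q - velX q) * velX qL'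
        - coefNu Γ q * pres qL')
      - lam1 Γ q * (srcU Γ src q + (coefM Γ q + lam4 Γ q - velX q) * velX qR'
        - coefNu Γ q * pres qR'))

/-- The limiting value of `∂p/∂t`. -/
noncomputable def acousticP (Γ : ℝ) (src q qL' qR' : Fin 4 → ℝ) : ℝ :=
  1 / (lam4 Γ q - lam1 Γ q) *
    (lam4 Γ q * (srcP Γ src q + (coefM Γ q + lam1 Γ q - velX q) * pres qL'
        - coefNp Γ q * velX qL')
      - lam1 Γ q * (srcP Γ src q + (coefM Γ q + lam4 Γ q - velX q) * pres qR'
        - coefNp Γ q * velX qR'))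

section Resolve

variable {Γ : ℝ} {src q qL' qR' a b : Fin 4 → ℝ}

/-- Half the sum and half the difference of the two characteristic equations give the time
derivatives of `u` and `Φ p`. They match the stated formulas because `M + λ₁ - u = -(λ₄ - λ₁) / 2`
and `M + λ₄ - u = (λ₄ - λ₁) / 2`. -/
theorem LinBalance.velX_pres_eq (hΓ : 1 < Γ) (hΓ' : Γ ≤ 2) (hq : Admissible q)
    (h₁ : lam1 Γ q < 0) (h₄ : 0 < lam4 Γ q) (h : LinBalance Γ src q a b)
    (hf : velX b + capPhi Γ q * pres b = velX qL' + capPhi Γ q * pres qL')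
    (hs : velX b - capPhi Γ q * pres b = velX qR' - capPhi Γ q * pres qR') :
    velX a = acousticU Γ src q qL' qR' ∧ pres a = acousticP Γ src q qL' qR' := by
  have e4 := h.fast hΓ hΓ' hq
  have e1 := h.slow hΓ hΓ' hq
  have hΦ := (capPhi_pos hΓ hΓ' hq).ne'
  have hl : lam4 Γ q - lam1 Γ q ≠ 0 := by linarith
  rw [hf] at e4
  rw [hs] at e1
  unfold acousticU acousticP coefM coefNu coefNp
  constructor
  · field_simp
    linear_combination (lam4 Γ q - lam1 Γ q) * (e4 + e1)
  · field_simp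
    linear_combination (lam4 Γ q - lam1 Γ q) * (e4 - e1)

theorem LinBalance.rho_eq (hΓ : 1 < Γ) (hq : Admissible q) (h : LinBalance Γ src q a b)
    {q' : Fin 4 → ℝ} (hc : pres b - soundSq Γ q * enthalpy Γ q * rho b
        = pres q' - soundSq Γ q * enthalpy Γ q * rho q') :
    rho a = upwindRho Γ src q q' (pres a) := by
  have e := h.entropy hΓ hq
  have h1 := (soundSq_pos hΓ hq).ne'
  have h2 := (enthalpy_pos hΓ hq).ne'
  unfold upwindRho
  rw [← e, ← hc]
  field_simp
  ring

theorem LinBalance.velY_eq (hΓ : 1 < Γ) (hq : Admissible q) (h : LinBalance Γ src q a b)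
    {q' : Fin 4 → ℝ} (hc : slopeTangential Γ q b = slopeTangential Γ q q') :
    velY a = upwindV Γ src q q' (rho a) (velX a) (pres a) := by
  have e := h.tangential hq
  have h1 := enthalpy_pos hΓ hq
  have h2 := lorentz_pos hq
  have h3 : enthalpy Γ q * lorentz q * (velY q ^ 2 * lorentz q ^ 2 + 1) ≠ 0 := by positivity
  unfold upwindV
  rw [← e, ← hc, div_mul_eq_mul_div, eq_div_iff h3, slopeTangential]
  ring

end Resolve

/-! ### Slow curves carry no acoustic jump -/

theorem IsSolutionOn.eventually_jump {Γ : ℝ} {src : Fin 4 → ℝ} {V₀ : ℝ → Fin 4 → ℝ}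
    {V : ℝ × ℝ → Fin 4 → ℝ} {T δ : ℝ} {n : ℕ} {s : Fin n → ℝ → ℝ}
    {G : ℕ → ℝ × ℝ → (ℝ × ℝ →L[ℝ] (Fin 4 → ℝ))} (S : IsSolutionOn Γ src V₀ V T δ s)
    (hG : IsPieceDeriv V T δ s G) (hΓ : 1 < Γ) (hΓ' : Γ ≤ 2) (hT : 0 < T) (hδ : 0 < δ)
    (h₁ : lam1 Γ (V (0, 0)) < 0) (h₄ : 0 < lam4 Γ (V (0, 0))) (i : Fin n) :
    ∀ᶠ t in 𝓝[>] (0 : ℝ), s i t = 0 →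
      (∀ j, j = 1 ∨ j = 3 ∨ velX (V (0, 0)) ≠ 0 →
        (G (i + 1) (t, 0) (0, 1) - G i (t, 0) (0, 1)) j = 0) := by
  have hδ0 : (0 : ℝ) ∈ Ioo (-δ) δ := ⟨neg_lt_zero.2 hδ, hδ⟩
  have hST : ((0 : ℝ), (0 : ℝ)) ∈ spaceTime T δ := ⟨⟨le_rfl, hT⟩, hδ0⟩
  obtain ⟨σ, hσ, hσ'⟩ := S.exists_initial_speed i hT
  by_cases h0 : σ = 0
  swap
  · filter_upwards [hσ.eventually_ne h0] with t ht hst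
    -- A curve with nonzero initial speed does not return to `x = 0` at small times.
    exact absurd (by simp [hst]) ht
  subst h0
  have hVt : Tendsto (fun t : ℝ => V (t, 0)) (𝓝[>] 0) (𝓝 (V (0, 0))) := by
    refine (S.continuousOn _ hST).tendsto.comp (tendsto_nhdsWithin_iff.2
      ⟨(tendsto_id.mono_left nhdsWithin_le_nhds).prodMk_nhds tendsto_const_nhds, ?_⟩)
    filter_upwards [Ioo_mem_nhdsGT hT] with t ht using ⟨Ioo_subset_Ico_self ht, hδ0⟩
  have hlam := tendsto_lam hΓ hΓ' hVt (S.admissible _ hST)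
  have hu : ∀ᶠ t in 𝓝[>] (0 : ℝ), velX (V (0, 0)) ≠ 0 → deriv (s i) t ≠ velX (V (t, 0)) := by
    by_cases hu : velX (V (0, 0)) = 0
    · exact Eventually.of_forall fun t h => absurd hu h
    · have h1 : Tendsto (fun t => deriv (s i) t - velX (V (t, 0))) (𝓝[>] 0)
          (𝓝 (0 - velX (V (0, 0)))) := hσ'.sub (tendsto_pi_nhds.1 hVt 1)
      filter_upwards [h1.eventually_ne (b₂ := 0) (by simpa using hu)] with t ht _
      exact sub_ne_zero.1 ht
  -- The jump is taken at `(t, 0)`, not at the origin, so the speed of the curve must be compared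
  -- with the eigenvalues at the nearby state `V (t, 0)`.
  filter_upwards [Ioo_mem_nhdsGT hT, hlam.1.eventually_lt hσ' h₁, hσ'.eventually_lt hlam.2 h₄, hu]
    with t ht hl1 hl4 hu hst j hj
  have hx : s i t ∈ Ioo (-δ) δ := hst ▸ hδ0
  have hJ := S.isJump_curve hG hΓ i ht hx
  rw [hst] at hJ
  have hq := S.admissible (t, 0) ⟨Ioo_subset_Ico_self ht, hδ0⟩
  obtain ⟨e1, e3⟩ := hJ.velX_pres_eq_zero hΓ hΓ' hq hl4.ne hl1.ne'
  rcases hj with rfl | rfl | hj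
  · exact e1
  · exact e3
  · obtain ⟨e0, e2⟩ := hJ.rho_velY_eq_zero hΓ hΓ' hq hl4.ne hl1.ne' (hu hj)
    fin_cases j
    exacts [e0, e1, e2, e3]

end RHD

open RHD

/-! ### The limits along `x = 0` -/

theorem mainTheorem6 (Γ : ℝ) (hΓ : 1 < Γ) (hΓ' : Γ ≤ 2)
    (src : Fin 4 → ℝ) (V₀ : ℝ → Fin 4 → ℝ) (V : ℝ × ℝ → Fin 4 → ℝ)
    (hV : IsLocalSolution Γ src V₀ V)
    (q qL' qR' : Fin 4 → ℝ) (hq : V₀ 0 = q)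
    (hL : HasDerivWithinAt V₀ qL' (Iic 0) 0) (hR : HasDerivWithinAt V₀ qR' (Ici 0) 0)
    (h₁ : lam1 Γ q < 0) (h₄ : 0 < lam4 Γ q) :
    ∃ ut pt : ℝ,
      HasLimitTimeDeriv V 1 ut ∧ HasLimitTimeDeriv V 3 pt ∧
      ut = 1 / (lam4 Γ q - lam1 Γ q) *
        (lam4 Γ q * (srcU Γ src q + (coefM Γ q + lam1 Γ q - velX q) * velX qL'
            - coefNu Γ q * pres qL')
          - lam1 Γ q * (srcU Γ src q + (coefM Γ q + lam4 Γ q - velX q) * velX qR'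
            - coefNu Γ q * pres qR')) ∧
      pt = 1 / (lam4 Γ q - lam1 Γ q) *
        (lam4 Γ q * (srcP Γ src q + (coefM Γ q + lam1 Γ q - velX q) * pres qL'
            - coefNp Γ q * velX qL')
          - lam1 Γ q * (srcP Γ src q + (coefM Γ q + lam4 Γ q - velX q) * pres qR'
            - coefNp Γ q * velX qR')) ∧
      (0 < velX q → ∃ ρt vt : ℝ,
        HasLimitTimeDeriv V 0 ρt ∧ HasLimitTimeDeriv V 2 vt ∧
        ρt = upwindRho Γ src q qL' pt ∧ vt = upwindV Γ src q qL' ρt ut pt) ∧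
      (velX q < 0 → ∃ ρt vt : ℝ,
        HasLimitTimeDeriv V 0 ρt ∧ HasLimitTimeDeriv V 2 vt ∧
        ρt = upwindRho Γ src q qR' pt ∧ vt = upwindV Γ src q qR' ρt ut pt) := by
  obtain ⟨T, hT, δ, hδ, n, s, S⟩ := hV
  obtain ⟨G, hG⟩ := S.exists_isPieceDeriv
  have hδ0 : (0 : ℝ) ∈ Ioo (-δ) δ := ⟨neg_lt_zero.2 hδ, hδ⟩
  have hST : ((0 : ℝ), (0 : ℝ)) ∈ spaceTime T δ := ⟨⟨le_rfl, hT⟩, hδ0⟩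
  obtain rfl : V (0, 0) = q := (S.initial 0 hδ0).trans hq
  have hqa := S.admissible _ hST
  choose σ hσ hσ' using fun i => S.exists_initial_speed i hT
  have hb : ∀ i : Fin n, IsJump Γ (V (0, 0)) (σ i)
      (G (i + 1) (0, 0) (0, 1) - G i (0, 0) (0, 1)) := fun i =>
    S.isJump_origin hG hΓ hT hδ i (hσ' i)
  have hbL := S.slope_left hG hT hδ hL
  have hbR := S.slope_right hG hT hδ hR
  have hlin : ∀ k ≤ n, LinBalance Γ src (V (0, 0)) (G k (0, 0) (1, 0)) (G k (0, 0) (0, 1)) :=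
    fun k hk => S.linBalance hG hΓ hk ⟨S.zero_mem_closure_sector hG hT hδ hk, hST⟩
  -- Fast information arrives from the left datum and slow information from the right one, whichever
  -- central sector is considered.
  have hac : ∀ k ≤ n, IsCentral σ k →
      velX (G k (0, 0) (1, 0)) = acousticU Γ src (V (0, 0)) qL' qR' ∧
      pres (G k (0, 0) (1, 0)) = acousticP Γ src (V (0, 0)) qL' qR' := fun k hk hc =>
    (hlin k hk).velX_pres_eq hΓ hΓ' hqa h₁ h₄
      (hbL ▸ fast_eq_left (b := fun k => G k (0, 0) (0, 1)) hΓ hΓ' hqa h₄ hb hk hc)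
      (hbR ▸ slow_eq_right (b := fun k => G k (0, 0) (0, 1)) hΓ hΓ' hqa h₁ hb hk hc)
  have hlim : ∀ (j : Fin 4) (a : ℝ), j = 1 ∨ j = 3 ∨ velX (V (0, 0)) ≠ 0 →
      (∀ k ≤ n, IsCentral σ k → G k (0, 0) (1, 0) j = a) → HasLimitTimeDeriv V j a :=
    fun j a hj ha => S.hasLimitTimeDeriv hG hT hδ hσ j ha fun i =>
      (S.eventually_jump hG hΓ hΓ' hT hδ h₁ h₄ i).mono fun t h hst => h hst j hj
  refine ⟨acousticU Γ src (V (0, 0)) qL' qR', acousticP Γ src (V (0, 0)) qL' qR',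
    hlim 1 _ (by simp) fun k hk hc => (hac k hk hc).1,
    hlim 3 _ (by simp) fun k hk hc => (hac k hk hc).2, rfl, rfl, fun hu => ?_, fun hu => ?_⟩
  · have hcon : ∀ k ≤ n, IsCentral σ k → _ := fun k hk hc =>
      contact_eq_left (b := fun k => G k (0, 0) (0, 1)) hΓ hqa hu hb hk hc
    rw [hbL] at hcon
    have hρ : ∀ k ≤ n, IsCentral σ k → rho (G k (0, 0) (1, 0)) =
        upwindRho Γ src (V (0, 0)) qL' (acousticP Γ src (V (0, 0)) qL' qR') := fun k hk hc =>
      (hac k hk hc).2 ▸ (hlin k hk).rho_eq hΓ hqa (hcon k hk hc).1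
    refine ⟨_, _, hlim 0 _ (by simp [hu.ne']) hρ, hlim 2 _ (by simp [hu.ne']) fun k hk hc => ?_,
      rfl, rfl⟩
    rw [← hρ k hk hc, ← (hac k hk hc).1, ← (hac k hk hc).2]
    exact (hlin k hk).velY_eq hΓ hqa (hcon k hk hc).2
  · have hcon : ∀ k ≤ n, IsCentral σ k → _ := fun k hk hc =>
      contact_eq_right (b := fun k => G k (0, 0) (0, 1)) hΓ hqa hu hb hk hc
    rw [hbR] at hcon
    have hρ : ∀ k ≤ n, IsCentral σ k → rho (G k (0, 0) (1, 0)) =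
        upwindRho Γ src (V (0, 0)) qR' (acousticP Γ src (V (0, 0)) qL' qR') := fun k hk hc =>
      (hac k hk hc).2 ▸ (hlin k hk).rho_eq hΓ hqa (hcon k hk hc).1
    refine ⟨_, _, hlim 0 _ (by simp [hu.ne]) hρ, hlim 2 _ (by simp [hu.ne]) fun k hk hc => ?_,
      rfl, rfl⟩
    rw [← hρ k hk hc, ← (hac k hk hc).1, ← (hac k hk hc).2]
    exact (hlin k hk).velY_eq hΓ hqa (hcon k hk hc).2
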